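/- For $n\in\mathbb N$ let $p=p(n)\in[0,1]$, and let $\mathbf G(n,p)$ be the Erdős–Rényi random graph on $n$ vertices, in which each edge of the complete graph is kept independently with probability $p$. For a fixed $d\in\mathbb N_0$ let $V_d$ be the number of vertices of degree $d$ in $\mathbf G(n,p)$, and let $F_d:=(V_d-\mathbb E V_d)/\sqrt{\mathrm{Var}(V_d)}$. Let $N\sim\mathcal N(0,1)$, and let $d_K(X,Y):=\sup_{z\in\mathbb R}|\mathbb P(X\le z)-\mathbb P(Y\le z)|$ denote the Kolmogorov distance. All asymptotics are as $n\to\infty$, and the constants implied by $\mathcal O$ may depend on $d$ and on the sequence $p$. (a) Assume that $np=\mathcal O(1)$ and $n^2p\to\infty$. Then $d_K(F_0,N)=\mathcal O(n^{-1}p^{-1/2})$. (b) Assume that $np=\mathcal O(1)$ and $(np)^{-d}p^{1/2}\to0$. (i) If in addition $\liminf_{n\to\infty}np>0$, then $d_K(F_d,N)=\mathcal O(n^{-1/2})$. (ii) If in addition $d\ge1$, $np\to0$, and $p>0$ for all sufficiently large $n$, then $d_K(F_d,N)=\mathcal O\big((np)^{-d}p^{1/2}\big)$. -/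

import Mathlib

open MeasureTheory ProbabilityTheory Filter Topology Asymptotics

noncomputable section

/-- The Kolmogorov distance `sup_z |P(X ≤ z) - Q(Y ≤ z)|` between a real random variable `X` on
`(Ω, P)` and a real random variable `Y` on `(Ω', Q)`. It depends on the two laws only. -/
def kolmogorovDist {Ω Ω' : Type*} [MeasurableSpace Ω] [MeasurableSpace Ω']
    (X : Ω → ℝ) (P : Measure Ω) (Y : Ω' → ℝ) (Q : Measure Ω') : ℝ :=
  ⨆ z : ℝ, |P.real {ω | X ω ≤ z} - Q.real {ω | Y ω ≤ z}|

/-- The law of the Erdős–Rényi random graph on `n` labelled vertices: each edge of the complete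
graph is kept with probability `p`, independently of the others. -/
def erdosRenyi (n : ℕ) (p : unitInterval) : Measure (SimpleGraph (Fin n)) :=
  SimpleGraph.binomialRandom (Fin n) p

open Classical in
/-- `V_d`, the number of vertices of degree `d` of a graph on `n` vertices. -/
def numVerticesOfDegree (d n : ℕ) (G : SimpleGraph (Fin n)) : ℝ :=
  ((Finset.univ.filter fun v : Fin n => G.degree v = d).card : ℝ)

/-- `F_d = (V_d - E V_d) / √(Var V_d)`, where expectation and variance are those under `G(n,p)`. -/
def normalizedDegreeCount (d n : ℕ) (p : unitInterval) (G : SimpleGraph (Fin n)) : ℝ :=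
  (numVerticesOfDegree d n G - ∫ H, numVerticesOfDegree d n H ∂(erdosRenyi n p)) /
    √(variance (numVerticesOfDegree d n) (erdosRenyi n p))

end

/-! The argument is Stein's method combined with integration by parts for the resampling dynamics on
the cube of edge configurations. Write `v = p(1-p)`, `D_j` for the discrete derivative and `L` for
the generator. If `F - E F = -L H`, then `Cov(F, G) = v ∑_j E[D_j H · D_j G]`. Since `D_j L = L D_j
- D_j`, the derivatives of `H` solve resolvent equations driven by those of `F`, and the maximum
principle bounds first and second derivatives of `H` by the bounds for `F`. No explicit form of `H`
is needed.

Let `W = (F - E F)/σ`, let `f` be the bounded Stein solution for the half-line `(-∞, z]`, and let `T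
= (v/σ²) ∑_j D_j H · D_j F`, which has mean 1. Replacing `D_j f(W)` by `D_j W · f'(W)` in `E[W
f(W)]` leaves two errors. The first is `E[f'(W)(1 - T)]`, controlled by the Poincaré inequality for
`T`. The second, from the Taylor remainder, is at most `v ∑_j E[u_j · D_j h(W)]`, where `u_j = |D_j
H| D_j F / σ²` and `h(w) = w f(w) - 1_{w ≤ z}` is nondecreasing and bounded. Integrating by parts
back turns this into `E[δ h(W)]` with `δ` the divergence of `u`, so only `E|δ|` matters. The jump of
the indicator thus costs nothing in the rate (`abs_expect_ind_sub_cdf_le`).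

For degree counts an edge affects two vertices, and second derivatives vanish unless the edges share
a vertex. With `np ≤ K` the error is therefore of order `n √p / Var V_d`. Two stars share a single
edge, so the indicators of distinct vertices are nonnegatively correlated and `Var V_d ≥ n π (1 -
π)`, where `π` is the probability that a vertex has degree `d`. This is at least a constant times
`n² p` for `d = 0` and `n (np)^d` for `d ≥ 1`, which gives all the rates. -/

/-! ### Calculus on the biased discrete cube

Points of the cube `{0,1}^ι` are represented by finite sets of coordinates. -/

namespace BiasedCube

open Finset

variable {ι : Type*}

section Expectation

variable [Fintype ι]

/-- Expectation when each coordinate is present independently with probability `p`. -/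
def expect (p : ℝ) (F : Finset ι → ℝ) : ℝ :=
  ∑ s, p ^ #s * (1 - p) ^ (Fintype.card ι - #s) * F s

lemma expect_add (p : ℝ) (F G : Finset ι → ℝ) :
    expect p (fun s => F s + G s) = expect p F + expect p G := by
  simp [expect, mul_add, sum_add_distrib]

lemma expect_sub (p : ℝ) (F G : Finset ι → ℝ) :
    expect p (fun s => F s - G s) = expect p F - expect p G := by
  simp [expect, mul_sub, sum_sub_distrib]

lemma expect_const_mul (p c : ℝ) (F : Finset ι → ℝ) :
    expect p (fun s => c * F s) = c * expect p F := by
  simp only [expect, mul_sum]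
  exact sum_congr rfl fun _ _ => by ring

lemma expect_sum {κ : Type*} (t : Finset κ) (p : ℝ) (F : κ → Finset ι → ℝ) :
    expect p (fun s => ∑ k ∈ t, F k s) = ∑ k ∈ t, expect p (F k) := by
  simp only [expect, mul_sum]
  exact sum_comm

@[simp] lemma expect_const (p c : ℝ) : expect p (fun _ : Finset ι => c) = c := by
  have := Fintype.sum_pow_mul_eq_add_pow ι p (1 - p)
  simp only [expect, ← sum_mul, this]
  simp

lemma expect_mono {p : ℝ} (h0 : 0 ≤ p) (h1 : p ≤ 1) {F G : Finset ι → ℝ} (h : ∀ s, F s ≤ G s) :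
    expect p F ≤ expect p G :=
  sum_le_sum fun s _ => mul_le_mul_of_nonneg_left (h s)
    (mul_nonneg (pow_nonneg h0 _) (pow_nonneg (by linarith) _))

lemma abs_expect_le {p : ℝ} (h0 : 0 ≤ p) (h1 : p ≤ 1) (F : Finset ι → ℝ) :
    |expect p F| ≤ expect p (fun s => |F s|) := by
  rw [abs_le]
  constructor
  · have := expect_mono h0 h1 (F := fun s => (-1) * |F s|) (G := F)
      (fun s => by linarith [neg_abs_le (F s)])
    rw [expect_const_mul] at this; linarith
  · exact expect_mono h0 h1 fun s => le_abs_self _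

lemma expect_abs_le_of_expect_sq_le {p : ℝ} (h0 : 0 ≤ p) (h1 : p ≤ 1) {F : Finset ι → ℝ} {c : ℝ}
    (hc : 0 ≤ c) (h : expect p (fun s => F s ^ 2) ≤ c ^ 2) : expect p (fun s => |F s|) ≤ c := by
  set m := expect p fun s => |F s| with hm
  -- Cauchy–Schwarz by averaging `2m|F| ≤ F² + m²`, which yields `m² ≤ E F²`.
  have := expect_mono h0 h1 (F := fun s => 2 * m * |F s|) (G := fun s => F s ^ 2 + m ^ 2)
    (fun s => by nlinarith [sq_nonneg (|F s| - m), sq_abs (F s)])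
  rw [expect_const_mul, expect_add, expect_const, ← hm] at this
  exact abs_le_of_sq_le_sq' (by nlinarith) hc |>.2

lemma eq_zero_of_expect_sq {p : ℝ} (h0 : 0 < p) (h1 : p < 1) {F : Finset ι → ℝ}
    (h : expect p (fun s => F s * F s) = 0) (s : Finset ι) : F s = 0 := by
  have hw : ∀ s : Finset ι, 0 < p ^ #s * (1 - p) ^ (Fintype.card ι - #s) := fun s =>
    mul_pos (pow_pos h0 _) (pow_pos (by linarith) _)
  rw [expect, sum_eq_zero_iff_of_nonneg
    fun s _ => mul_nonneg (hw s).le (mul_self_nonneg _)] at h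
  have := h s (mem_univ _)
  simpa [(hw s).ne'] using this

end Expectation

/-! ### Discrete derivatives and resampling of one coordinate. -/

variable [DecidableEq ι]

/-- The discrete derivative in direction `j`. -/
def diff (j : ι) (F : Finset ι → ℝ) (s : Finset ι) : ℝ := F (insert j s) - F (s.erase j)

/-- Average of `F` over the coordinate `j`. -/
def resample (p : ℝ) (j : ι) (F : Finset ι → ℝ) (s : Finset ι) : ℝ :=
  p * F (insert j s) + (1 - p) * F (s.erase j)

/-- The centred coordinate `x_j - p`. -/
def centred (p : ℝ) (j : ι) (s : Finset ι) : ℝ := if j ∈ s then 1 - p else -p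

lemma eq_insert_or_eq_erase (j : ι) (s : Finset ι) : s = insert j s ∨ s = s.erase j := by
  by_cases h : j ∈ s
  · left; rw [insert_eq_of_mem h]
  · right; rw [erase_eq_of_notMem h]

@[simp] lemma insert_erase_self (j : ι) (s : Finset ι) : insert j (s.erase j) = insert j s := by
  ext x; by_cases x = j <;> simp_all

lemma insert_erase_of_ne {j k : ι} (h : j ≠ k) (s : Finset ι) :
    insert j (s.erase k) = (insert j s).erase k := by
  ext x; simp only [mem_insert, mem_erase]; grind

@[simp] lemma diff_diff_self (j : ι) (F : Finset ι → ℝ) (s : Finset ι) :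
    diff j (diff j F) s = 0 := by
  simp [diff]

lemma diff_comm (j k : ι) (F : Finset ι → ℝ) : diff j (diff k F) = diff k (diff j F) := by
  funext s
  by_cases h : j = k
  · subst h; rfl
  simp only [diff, insert_erase_of_ne h, insert_erase_of_ne (Ne.symm h), Finset.insert_comm j k,
    erase_right_comm (a := j) (b := k)]
  ring

lemma diff_mul (j : ι) (F G : Finset ι → ℝ) (s : Finset ι) :
    diff j (fun t => F t * G t) s =
      diff j F s * G (insert j s) + F (s.erase j) * diff j G s := by
  simp only [diff]; ring

/-- A function that does not depend on the coordinate `j` is a scalar for `D_j`. -/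
lemma diff_mul_of_diff_eq_zero {j : ι} {F : Finset ι → ℝ} (hF : ∀ s, diff j F s = 0)
    (G : Finset ι → ℝ) (s : Finset ι) :
    diff j (fun t => F t * G t) s = F s * diff j G s := by
  have h := hF s
  simp only [diff] at *
  rcases eq_insert_or_eq_erase j s with hs | hs
  · rw [show F s = F (insert j s) by rw [← hs]]; linear_combination G (s.erase j) * h
  · rw [show F s = F (s.erase j) by rw [← hs]]; linear_combination G (insert j s) * h

lemma diff_sum {κ : Type*} (t : Finset κ) (j : ι) (F : κ → Finset ι → ℝ) (s : Finset ι) :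
    diff j (fun u => ∑ k ∈ t, F k u) s = ∑ k ∈ t, diff j (F k) s := by
  simp [diff, sum_sub_distrib]

lemma diff_const_mul (j : ι) (c : ℝ) (F : Finset ι → ℝ) (s : Finset ι) :
    diff j (fun u => c * F u) s = c * diff j F s := by
  simp only [diff]; ring

lemma diff_sub_const (j : ι) (c : ℝ) (F : Finset ι → ℝ) (s : Finset ι) :
    diff j (fun u => F u - c) s = diff j F s := by
  simp only [diff]; ring

lemma abs_diff_abs_le (j : ι) (F : Finset ι → ℝ) (s : Finset ι) :
    |diff j (fun u => |F u|) s| ≤ |diff j F s| :=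
  abs_abs_sub_abs_le_abs_sub _ _

lemma diff_centred_self (p : ℝ) (j : ι) (s : Finset ι) : diff j (centred p j) s = 1 := by
  simp [diff, centred]

lemma diff_centred_of_ne (p : ℝ) {j k : ι} (h : j ≠ k) (s : Finset ι) :
    diff j (centred p k) s = 0 := by
  simp [diff, centred, h.symm]

lemma resample_sub_self (p : ℝ) (j : ι) (F G : Finset ι → ℝ) (s : Finset ι) :
    resample p j (fun t => (F t - resample p j F t) * G t) s =
      p * (1 - p) * (diff j F s * diff j G s) := by
  simp only [resample, diff, insert_idem, insert_erase_self, erase_insert_eq_erase, erase_idem]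
  ring

lemma resample_centred_mul (p : ℝ) (j : ι) (G : Finset ι → ℝ) (s : Finset ι) :
    resample p j (fun t => centred p j t * G t) s = p * (1 - p) * diff j G s := by
  simp [resample, diff, centred]
  ring

lemma eq_const_of_diff_eq_zero {H : Finset ι → ℝ} (h : ∀ j s, diff j H s = 0) (s : Finset ι) :
    H s = H ∅ := by
  induction s using Finset.induction_on with
  | empty => rfl
  | insert j s hj ih =>
    have := h j s
    rw [diff, erase_eq_of_notMem hj] at this
    linarith

/-! ### The generator, its resolvent and the Poisson equation. -/

variable [Fintype ι]

/-- Generator of the Markov process that resamples each coordinate at rate one. -/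
def gen (p : ℝ) (F : Finset ι → ℝ) (s : Finset ι) : ℝ := ∑ j, (resample p j F s - F s)

lemma expect_resample (p : ℝ) (j : ι) (F : Finset ι → ℝ) :
    expect p (resample p j F) = expect p F := by
  -- Pair each set avoiding `j` with the same set with `j` added; resampling does not change the
  -- inner average.
  have key : ∀ G : Finset ι → ℝ, expect p G = ∑ t ∈ (univ.erase j).powerset,
      p ^ #t * (1 - p) ^ (Fintype.card ι - 1 - #t) *
        (p * G (insert j t) + (1 - p) * G t) := by
    intro G
    have hu : (univ : Finset (Finset ι)) = (insert j (univ.erase j)).powerset := by simp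
    rw [expect, hu, sum_powerset_insert (by simp), ← sum_add_distrib]
    refine sum_congr rfl fun t ht => ?_
    have hjt : j ∉ t := fun h => by simpa using mem_powerset.1 ht h
    have hc : #t + 1 ≤ Fintype.card ι := by
      rw [← card_insert_of_notMem hjt]; exact card_le_univ _
    rw [card_insert_of_notMem hjt, show Fintype.card ι - #t = Fintype.card ι - 1 - #t + 1 by omega,
      show Fintype.card ι - (#t + 1) = Fintype.card ι - 1 - #t by omega]
    ring
  rw [key, key]
  refine sum_congr rfl fun t ht => ?_
  have hjt : j ∉ t := fun h => by simpa using mem_powerset.1 ht h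
  simp only [resample, insert_idem, erase_insert hjt, erase_eq_of_notMem hjt]
  ring

lemma expect_centred_mul (p : ℝ) (j : ι) (G : Finset ι → ℝ) :
    expect p (fun s => centred p j s * G s) = p * (1 - p) * expect p (diff j G) := by
  rw [← expect_resample p j, ← expect_const_mul]
  congr 1; funext s; exact resample_centred_mul p j G s

lemma expect_gen_mul (p : ℝ) (H G : Finset ι → ℝ) :
    expect p (fun s => gen p H s * G s) =
      -(p * (1 - p) * ∑ j, expect p (fun s => diff j H s * diff j G s)) := by
  have h1 : (fun s => gen p H s * G s) =
      fun s => (-1) * ∑ j, (H s - resample p j H s) * G s := by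
    funext s
    rw [gen, sum_mul, mul_sum]
    exact sum_congr rfl fun j _ => by ring
  rw [h1, expect_const_mul, expect_sum, neg_one_mul, mul_sum]
  congr 1
  refine sum_congr rfl fun j _ => ?_
  rw [← expect_resample p j, ← expect_const_mul]
  congr 1; funext s; exact resample_sub_self p j H G s

lemma expect_gen (p : ℝ) (H : Finset ι → ℝ) : expect p (gen p H) = 0 := by
  have := expect_gen_mul p H (fun _ => 1)
  simpa [diff] using this

/-- `D_k` commutes with resampling any coordinate other than `k`, and annihilates the resampling of
`k` itself. That one term produces the shift by `-D_k`, hence the constants 1 and 2 in the resolvent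
equations for first and second derivatives. -/
lemma diff_gen (p : ℝ) (k : ι) (H : Finset ι → ℝ) (s : Finset ι) :
    diff k (gen p H) s = gen p (diff k H) s - diff k H s := by
  have h : ∀ j, diff k (fun s => resample p j H s - H s) s =
      resample p j (diff k H) s - diff k H s - if j = k then diff k H s else 0 := by
    intro j
    by_cases h : j = k
    · subst h
      simp [diff, resample]; ring
    · simp only [diff, resample, insert_erase_of_ne h, insert_erase_of_ne (Ne.symm h),
        Finset.insert_comm j k, erase_right_comm (a := j) (b := k), if_neg h]
      ring
  have : gen p H = fun s => ∑ j, (resample p j H s - H s) := rfl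
  rw [this, diff_sum, sum_congr rfl fun j _ => h j, sum_sub_distrib]
  simp [gen]

/-- Maximum principle for the resolvent of the generator. -/
lemma le_of_resolvent {p c B : ℝ} (h0 : 0 ≤ p) (h1 : p ≤ 1) (hc : 0 < c) {w : Finset ι → ℝ}
    (h : ∀ s, c * w s - gen p w s ≤ B) (s : Finset ι) : w s ≤ B / c := by
  obtain ⟨m, -, hm⟩ := exists_max_image univ w ⟨∅, mem_univ _⟩
  have hg : gen p w m ≤ 0 := by
    refine sum_nonpos fun j _ => ?_
    simp only [resample]
    nlinarith [hm (insert j m) (mem_univ _), hm (m.erase j) (mem_univ _)]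
  have := hm s (mem_univ _)
  rw [le_div_iff₀ hc]
  nlinarith [h m]

lemma gen_neg (p : ℝ) (w : Finset ι → ℝ) (s : Finset ι) :
    gen p (fun t => -w t) s = -gen p w s := by
  simp only [gen, resample, ← sum_neg_distrib]
  exact sum_congr rfl fun j _ => by ring

lemma abs_le_of_resolvent {p c B : ℝ} (h0 : 0 ≤ p) (h1 : p ≤ 1) (hc : 0 < c) {w : Finset ι → ℝ}
    (h : ∀ s, |c * w s - gen p w s| ≤ B) (s : Finset ι) : |w s| ≤ B / c := by
  rw [abs_le']
  refine ⟨le_of_resolvent h0 h1 hc (fun s => (abs_le.1 (h s)).2) s,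
    le_of_resolvent h0 h1 hc (w := fun t => -w t) (fun s => ?_) s⟩
  rw [gen_neg]
  linarith [(abs_le.1 (h s)).1]

/-- `H` solves the Poisson equation for `F`. -/
def IsPoissonSol (p : ℝ) (F H : Finset ι → ℝ) : Prop := ∀ s, F s - expect p F = -gen p H s

/-- Subtracting the mean makes the generator injective: a kernel element has mean zero and vanishing
Dirichlet form, hence is constant and so zero. In finite dimension injectivity gives surjectivity.
-/
lemma exists_isPoissonSol {p : ℝ} (h0 : 0 < p) (h1 : p < 1) (F : Finset ι → ℝ) :
    ∃ H, IsPoissonSol p F H := by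
  let L : (Finset ι → ℝ) →ₗ[ℝ] (Finset ι → ℝ) :=
    { toFun := fun H s => gen p H s - expect p H
      map_add' := fun G H => by
        funext s
        have : expect p (G + H) = expect p G + expect p H := expect_add p G H
        simp only [Pi.add_apply, this, gen, resample]
        rw [sub_add_sub_comm, ← sum_add_distrib]
        congr 1
        exact sum_congr rfl fun j _ => by ring
      map_smul' := fun c H => by
        funext s
        have : expect p (c • H) = c * expect p H := expect_const_mul p c H
        simp only [Pi.smul_apply, smul_eq_mul, this, gen, resample, RingHom.id_apply, mul_sub,
          mul_sum]
        congr 1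
        exact sum_congr rfl fun j _ => by ring }
  have hinj : Function.Injective L := by
    rw [injective_iff_map_eq_zero]
    intro H hH
    have hL : ∀ s, gen p H s - expect p H = 0 := fun s => congrFun hH s
    have hE : expect p H = 0 := by
      have h2 := expect_gen p H
      have h3 : gen p H = fun _ => expect p H := funext fun s => by linarith [hL s]
      rw [h3, expect_const] at h2
      exact h2
    have hgen : ∀ s, gen p H s = 0 := fun s => by linarith [hL s]
    have hD := expect_gen_mul p H H
    simp only [hgen, zero_mul, expect_const] at hD
    have hv : 0 < p * (1 - p) := mul_pos h0 (by linarith)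
    have hsum : ∑ j, expect p (fun s => diff j H s * diff j H s) = 0 := by
      rcases mul_eq_zero.1 (neg_eq_zero.1 hD.symm) with h | h
      · exact absurd h hv.ne'
      · exact h
    rw [sum_eq_zero_iff_of_nonneg] at hsum
    · have hc := eq_const_of_diff_eq_zero
        fun j s => eq_zero_of_expect_sq h0 h1 (hsum j (mem_univ _)) s
      have : H = fun _ => H ∅ := funext hc
      rw [this, expect_const] at hE
      rw [this, hE]; rfl
    · intro j _
      have := expect_mono h0.le h1.le (F := fun _ : Finset ι => (0 : ℝ))
        (G := fun s => diff j H s * diff j H s) (fun s => mul_self_nonneg _)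
      simpa using this
  obtain ⟨H, hH⟩ := (LinearMap.injective_iff_surjective.1 hinj) (fun s => expect p F - F s)
  have hL : ∀ s, gen p H s - expect p H = expect p F - F s := fun s => congrFun hH s
  have hE : expect p H = 0 := by
    have h2 : expect p (fun s => gen p H s - expect p H) =
      expect p (fun s => expect p F - F s) := congrArg _ (funext hL)
    rw [expect_sub, expect_sub, expect_gen, expect_const, expect_const] at h2
    linarith
  exact ⟨H, fun s => by linarith [hL s]⟩

namespace IsPoissonSol

variable {p : ℝ} {F H : Finset ι → ℝ}

lemma cov_eq (h : IsPoissonSol p F H) (G : Finset ι → ℝ) :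
    expect p (fun s => (F s - expect p F) * G s) =
      p * (1 - p) * ∑ j, expect p (fun s => diff j H s * diff j G s) := by
  have h1 : (fun s => (F s - expect p F) * G s) = fun s => (-1) * (gen p H s * G s) := by
    funext s; rw [h s]; ring
  rw [h1, expect_const_mul, expect_gen_mul]; ring

lemma diff_eq (h : IsPoissonSol p F H) (j : ι) (s : Finset ι) :
    1 * diff j H s - gen p (diff j H) s = diff j F s := by
  have h1 : F = fun s => (-1) * gen p H s - -expect p F := by
    funext s; linarith [h s]
  have h2 := diff_gen p j H s
  conv_rhs => rw [h1, diff_sub_const, diff_const_mul, h2]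
  ring

lemma diff_diff_eq (h : IsPoissonSol p F H) (j k : ι) (s : Finset ι) :
    2 * diff k (diff j H) s - gen p (diff k (diff j H)) s = diff k (diff j F) s := by
  have h1 : diff j F = fun s => 1 * diff j H s - gen p (diff j H) s :=
    funext fun s => (h.diff_eq j s).symm
  have h2 := diff_gen p k (diff j H) s
  have h3 : diff k (diff j F) s = diff k (diff j H) s - diff k (gen p (diff j H)) s := by
    rw [h1]; simp only [diff]; ring
  rw [h3, h2]; ring

lemma abs_diff_le (h : IsPoissonSol p F H) (h0 : 0 ≤ p) (h1 : p ≤ 1) {j : ι} {a : ℝ}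
    (ha : ∀ s, |diff j F s| ≤ a) (s : Finset ι) : |diff j H s| ≤ a := by
  have := abs_le_of_resolvent h0 h1 one_pos (w := diff j H) (B := a)
    (fun s => by rw [h.diff_eq]; exact ha s) s
  simpa using this

lemma abs_diff_diff_le (h : IsPoissonSol p F H) (h0 : 0 ≤ p) (h1 : p ≤ 1) {j k : ι} {b : ℝ}
    (hb : ∀ s, |diff k (diff j F) s| ≤ b) (s : Finset ι) : |diff k (diff j H) s| ≤ b := by
  have h2 := abs_le_of_resolvent h0 h1 two_pos (w := diff k (diff j H)) (B := b)
    (fun s => by rw [h.diff_diff_eq]; exact hb s) s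
  have : 0 ≤ b := (abs_nonneg _).trans (hb s)
  linarith

/-- Averaging the resolvent equation removes the generator term. -/
lemma expect_diff (h : IsPoissonSol p F H) (j : ι) :
    expect p (diff j H) = expect p (diff j F) := by
  have h1 : diff j F = fun s => 1 * diff j H s - gen p (diff j H) s :=
    funext fun s => (h.diff_eq j s).symm
  rw [h1, expect_sub, expect_const_mul, expect_gen]; ring

end IsPoissonSol

/-- Poincaré inequality with a uniform bound on the derivatives. -/
lemma variance_le_of_abs_diff_le {p : ℝ} (h0 : 0 < p) (h1 : p < 1) {T : Finset ι → ℝ} {B : ℝ}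
    (hB : ∀ j s, |diff j T s| ≤ B) :
    expect p (fun s => (T s - expect p T) ^ 2) ≤ p * (1 - p) * (Fintype.card ι * B ^ 2) := by
  obtain ⟨H, hH⟩ := exists_isPoissonSol h0 h1 T
  have h2 := hH.cov_eq (fun s => T s - expect p T)
  simp only [diff_sub_const, ← pow_two] at h2
  rw [h2]
  refine mul_le_mul_of_nonneg_left ?_ (mul_pos h0 (by linarith)).le
  rw [← nsmul_eq_mul, ← card_univ, ← sum_const]
  refine sum_le_sum fun j _ => ?_
  have := expect_mono h0.le h1.le (F := fun s => diff j H s * diff j T s) (G := fun _ => B ^ 2)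
    fun s => by
      have e1 := hH.abs_diff_le h0.le h1.le (hB j) s
      calc _ ≤ |diff j H s * diff j T s| := le_abs_self _
        _ = |diff j H s| * |diff j T s| := abs_mul _ _
        _ ≤ B * B := mul_le_mul e1 (hB j s) (abs_nonneg _) ((abs_nonneg _).trans e1)
        _ = B ^ 2 := by ring
  simpa using this

/-- Second moment of the divergence of a field whose `j`-th component does not depend on the
coordinate `j`. -/
lemma expect_divergence_sq (p : ℝ) {u : ι → Finset ι → ℝ} (hu : ∀ j s, diff j (u j) s = 0) :
    expect p (fun s => (∑ j, centred p j s * u j s) ^ 2) =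
      p * (1 - p) * ∑ j, expect p (fun s => u j s ^ 2) +
      (p * (1 - p)) ^ 2 * ∑ j, ∑ k, expect p (fun s => diff k (u j) s * diff j (u k) s) := by
  have h1 : ∀ j k, expect p (fun s => centred p j s * u j s * (centred p k s * u k s)) =
      (if j = k then p * (1 - p) * expect p (fun s => u j s ^ 2) else 0) +
      (p * (1 - p)) ^ 2 * expect p (fun s => diff k (u j) s * diff j (u k) s) := by
    intro j k
    have e1 : (fun s => centred p j s * u j s * (centred p k s * u k s)) =
        fun s => centred p j s * (u j s * (centred p k s * u k s)) := by funext s; ring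
    have e2 : diff j (fun s => u j s * (centred p k s * u k s)) =
        fun s => u j s * diff j (fun s => centred p k s * u k s) s :=
      funext fun s => diff_mul_of_diff_eq_zero (hu j) _ s
    rw [e1, expect_centred_mul, e2]
    by_cases h : j = k
    · subst h
      have e3 : (fun s => u j s * diff j (fun s => centred p j s * u j s) s) =
          fun s => u j s ^ 2 := by
        funext s
        have : (fun s => centred p j s * u j s) = fun s => u j s * centred p j s := by
          funext s; ring
        rw [this, diff_mul_of_diff_eq_zero (hu j), diff_centred_self]; ring
      simp only [e3, if_true, hu, mul_zero, expect_const, add_zero]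
    · have e3 : (fun s => u j s * diff j (fun s => centred p k s * u k s) s) =
          fun s => centred p k s * (diff j (u k) s * u j s) := by
        funext s
        rw [diff_mul_of_diff_eq_zero (fun s => diff_centred_of_ne p h s)]; ring
      have e4 : diff k (fun s => diff j (u k) s * u j s) =
          -- After integrating by parts in `j`, a second one in `k` falls on `u j` alone, because
          -- `D_k D_j (u k) = D_j D_k (u k) = 0`.
          fun s => diff k (u j) s * diff j (u k) s := by
        funext s
        rw [diff_mul_of_diff_eq_zero (F := diff j (u k)) (fun s => ?_)]
        · ring
        · rw [diff_comm]
          have : diff k (u k) = fun _ => 0 := funext (hu k)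
          rw [this]; simp [diff]
      rw [e3, expect_centred_mul, e4, if_neg h]; ring
  have h2 : (fun s => (∑ j, centred p j s * u j s) ^ 2) =
      fun s => ∑ j, ∑ k, centred p j s * u j s * (centred p k s * u k s) := by
    funext s; rw [pow_two, sum_mul_sum]
  rw [h2, expect_sum]
  simp only [expect_sum, h1, sum_add_distrib, mul_sum]
  simp

end BiasedCube

/-! ### Stein's equation for half-lines -/

namespace SteinEquation

open Set Real

/-- The function `√(2π) e^{w²/2} Φ(w)`, where `Φ` is the standard normal distribution function. -/
noncomputable def mills (w : ℝ) : ℝ := exp (w ^ 2 / 2) * ∫ t in Iic w, exp (-t ^ 2 / 2)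

lemma integrable_exp_neg_sq_half : Integrable fun t : ℝ => exp (-t ^ 2 / 2) := by
  have := integrable_exp_neg_mul_sq (b := 1 / 2) (by norm_num)
  convert this using 3; ring

lemma integral_exp_neg_sq_half : ∫ t : ℝ, exp (-t ^ 2 / 2) = √(2 * π) := by
  have := integral_gaussian (1 / 2)
  convert this using 4 <;> ring

/-- Substituting `t = w - s` makes the integrand increasing and convex in `w`, so monotonicity and
convexity of `mills` are inherited from the exponential. -/
lemma mills_eq (w : ℝ) : mills w = ∫ s in Ioi (0 : ℝ), exp (w * s - s ^ 2 / 2) := by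
  have h1 : ∫ t in Iic w, exp (-t ^ 2 / 2) = ∫ s in Ioi (0 : ℝ), exp (-(w - s) ^ 2 / 2) := by
    rw [← integral_indicator measurableSet_Iic,
      ← integral_sub_left_eq_self (μ := volume) _ w,
      ← integral_Ici_eq_integral_Ioi, ← integral_indicator measurableSet_Ici]
    congr 1; funext s
    simp [indicator]
  rw [mills, h1, ← integral_const_mul]
  refine setIntegral_congr_fun measurableSet_Ioi fun s _ => ?_
  rw [← exp_add]; congr 1; ring

lemma integrable_exp_mul_sub_sq_half (w : ℝ) :
    Integrable fun s : ℝ => exp (w * s - s ^ 2 / 2) := by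
  have := (integrable_exp_neg_sq_half.comp_sub_right w).const_mul (exp (w ^ 2 / 2))
  convert this using 2 with s
  rw [← exp_add]; congr 1; ring

lemma mills_monotone : Monotone mills := by
  intro v w hvw
  rw [mills_eq, mills_eq]
  refine setIntegral_mono_on (integrable_exp_mul_sub_sq_half v).integrableOn
    (integrable_exp_mul_sub_sq_half w).integrableOn measurableSet_Ioi fun s hs => ?_
  have : (0 : ℝ) < s := hs
  gcongr

lemma mills_convexOn : ConvexOn ℝ univ mills := by
  refine ⟨convex_univ, fun v _ w _ a b ha hb hab => ?_⟩
  simp only [mills_eq, smul_eq_mul]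
  rw [← integral_const_mul, ← integral_const_mul, ← integral_add
    ((integrable_exp_mul_sub_sq_half v).integrableOn.const_mul a)
    ((integrable_exp_mul_sub_sq_half w).integrableOn.const_mul b)]
  refine setIntegral_mono_on (integrable_exp_mul_sub_sq_half _).integrableOn
    (((integrable_exp_mul_sub_sq_half v).integrableOn.const_mul a).add
    ((integrable_exp_mul_sub_sq_half w).integrableOn.const_mul b)) measurableSet_Ioi fun s _ => ?_
  have h := convexOn_exp.2 (mem_univ (v * s - s ^ 2 / 2)) (mem_univ (w * s - s ^ 2 / 2)) ha hb hab
  simp only [smul_eq_mul] at h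
  refine le_trans (le_of_eq ?_) h
  congr 1
  linear_combination (-s ^ 2 / 2) * hab.symm

lemma hasDerivAt_mills (w : ℝ) : HasDerivAt mills (w * mills w + 1) w := by
  have hc : Continuous fun t : ℝ => exp (-t ^ 2 / 2) := by fun_prop
  have h1 : ∀ u, ∫ t in Iic u, exp (-t ^ 2 / 2) =
      (∫ t in Iic 0, exp (-t ^ 2 / 2)) + ∫ t in (0 : ℝ)..u, exp (-t ^ 2 / 2) := by
    intro u
    rw [← intervalIntegral.integral_Iic_sub_Iic integrable_exp_neg_sq_half.integrableOn
      integrable_exp_neg_sq_half.integrableOn]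
    ring
  have h2 : HasDerivAt (fun u => ∫ t in Iic u, exp (-t ^ 2 / 2)) (exp (-w ^ 2 / 2)) w := by
    rw [funext h1]
    exact (intervalIntegral.integral_hasDerivAt_right (hc.intervalIntegrable _ _)
      (hc.stronglyMeasurableAtFilter _ _) hc.continuousAt).const_add _
  have h3 : HasDerivAt (fun u : ℝ => exp (u ^ 2 / 2)) (exp (w ^ 2 / 2) * w) w := by
    have : HasDerivAt (fun u : ℝ => u ^ 2 / 2) w w := by
      exact ((hasDerivAt_pow 2 w).div_const 2).congr_deriv (by norm_num)
    exact this.exp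
  have h4 := h3.mul h2
  have h5 : exp (w ^ 2 / 2) * exp (-w ^ 2 / 2) = 1 := by
    rw [← exp_add, ← exp_zero]; congr 1; ring
  refine h4.congr_deriv ?_
  rw [h5, mills]; ring

/-- The derivative of `mills` is `w * mills w + 1`, and it is nondecreasing by convexity. -/
lemma monotone_mul_mills : Monotone fun w => w * mills w := by
  have h := mills_convexOn.monotoneOn_deriv fun x _ => (hasDerivAt_mills x).differentiableAt
  intro v w hvw
  have := h (mem_univ v) (mem_univ w) hvw
  rw [(hasDerivAt_mills v).deriv, (hasDerivAt_mills w).deriv] at this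
  simpa using this

lemma neg_one_le_mul_mills (w : ℝ) : -1 ≤ w * mills w := by
  have h : 0 ≤ _root_.deriv mills w := mills_monotone.deriv_nonneg
  rw [(hasDerivAt_mills w).deriv] at h
  linarith

/-- The two branches of the Stein solution agree at `z`; by symmetry of the Gaussian, `mills (-z)`
carries the upper tail. -/
lemma mills_match (z : ℝ) :
    (1 - (gaussianReal 0 1).real (Iic z)) * mills z =
      (gaussianReal 0 1).real (Iic z) * mills (-z) := by
  have h1 : (gaussianReal 0 1).real (Iic z) = (√(2 * π))⁻¹ * ∫ t in Iic z, exp (-t ^ 2 / 2) := by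
    rw [measureReal_def, gaussianReal_apply_eq_integral 0 one_ne_zero, ENNReal.toReal_ofReal
      (integral_nonneg fun _ => gaussianPDFReal_nonneg _ _ _), ← integral_const_mul]
    simp [gaussianPDFReal]
  have h2 : ∫ t in Iic (-z), exp (-t ^ 2 / 2) =
      √(2 * π) - ∫ t in Iic z, exp (-t ^ 2 / 2) := by
    rw [← integral_comp_neg_Ioi, ← integral_exp_neg_sq_half,
      ← integral_add_compl (measurableSet_Iic (a := z)) integrable_exp_neg_sq_half, compl_Iic]
    simp
  have h3 : (√(2 * π)) ≠ 0 := by positivity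
  simp only [mills]
  rw [h1, h2, neg_sq]
  field_simp

/-- The bounded solution of Stein's equation `f'(w) - w f(w) = 1_{w ≤ z} - Φ(z)`. -/
noncomputable def sol (z w : ℝ) : ℝ :=
  if w ≤ z then (1 - (gaussianReal 0 1).real (Iic z)) * mills w
  else (gaussianReal 0 1).real (Iic z) * mills (-w)

/-- The indicator of `(-∞, z]`. -/
noncomputable def ind (z w : ℝ) : ℝ := if w ≤ z then 1 else 0

/-- The derivative of `sol z`, with the value at `z` prescribed by Stein's equation. -/
noncomputable def solDeriv (z w : ℝ) : ℝ :=
  w * sol z w + ind z w - (gaussianReal 0 1).real (Iic z)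

/-- The nondecreasing function `w f(w) - 1_{w ≤ z}`. -/
noncomputable def envelope (z w : ℝ) : ℝ := w * sol z w - ind z w

lemma sol_of_ge {z w : ℝ} (h : z ≤ w) :
    sol z w = (gaussianReal 0 1).real (Iic z) * mills (-w) := by
  rcases h.eq_or_lt with rfl | h
  · rw [sol, if_pos le_rfl, mills_match]
  · rw [sol, if_neg h.not_ge]

lemma cdf_mem (z : ℝ) :
    0 ≤ (gaussianReal 0 1).real (Iic z) ∧ (gaussianReal 0 1).real (Iic z) ≤ 1 :=
  ⟨measureReal_nonneg, measureReal_le_one⟩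

lemma monotone_mul_sol (z : ℝ) : Monotone fun w => w * sol z w := by
  obtain ⟨h0, h1⟩ := cdf_mem z
  have hl : ∀ v w, v ≤ w → w ≤ z → v * sol z v ≤ w * sol z w := by
    intro v w hvw hw
    rw [sol, if_pos (hvw.trans hw), sol, if_pos hw]
    nlinarith [monotone_mul_mills hvw]
  have hr : ∀ v w, v ≤ w → z ≤ v → v * sol z v ≤ w * sol z w := by
    intro v w hvw hv
    rw [sol_of_ge hv, sol_of_ge (hv.trans hvw)]
    nlinarith [monotone_mul_mills (neg_le_neg hvw)]
  intro v w hvw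
  rcases le_total w z with hw | hw
  · exact hl v w hvw hw
  rcases le_total v z with hv | hv
  · exact (hl v z hv le_rfl).trans (hr z w hw le_rfl)
  · exact hr v w hvw hv

/-- Each branch gives one of the two bounds directly; monotonicity through the point `z` carries it
to the other branch. -/
lemma abs_mul_sol_le (z w : ℝ) : |w * sol z w| ≤ 1 := by
  obtain ⟨h0, h1⟩ := cdf_mem z
  have hl : ∀ w, w ≤ z → -1 ≤ w * sol z w := by
    intro w hw
    rw [sol, if_pos hw]
    nlinarith [neg_one_le_mul_mills w]
  have hr : ∀ w, z ≤ w → w * sol z w ≤ 1 := by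
    intro w hw
    rw [sol_of_ge hw]
    nlinarith [neg_one_le_mul_mills (-w)]
  rw [abs_le]
  rcases le_total w z with hw | hw
  · exact ⟨hl w hw, (monotone_mul_sol z hw).trans (hr z le_rfl)⟩
  · exact ⟨(hl z le_rfl).trans (monotone_mul_sol z hw), hr w hw⟩

lemma ind_mem (z w : ℝ) : 0 ≤ ind z w ∧ ind z w ≤ 1 := by
  unfold ind; split_ifs <;> norm_num

lemma abs_solDeriv_le (z w : ℝ) : |solDeriv z w| ≤ 2 := by
  have h1 := abs_le.1 (abs_mul_sol_le z w)
  have h2 := ind_mem z w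
  have h3 := cdf_mem z
  rw [solDeriv, abs_le]
  constructor <;> linarith

lemma abs_envelope_le (z w : ℝ) : |envelope z w| ≤ 2 := by
  have h1 := abs_le.1 (abs_mul_sol_le z w)
  have h2 := ind_mem z w
  rw [envelope, abs_le]
  constructor <;> linarith

lemma continuous_mills : Continuous mills :=
  continuous_iff_continuousAt.2 fun w => (hasDerivAt_mills w).continuousAt

lemma continuous_sol (z : ℝ) : Continuous (sol z) := by
  have := continuous_mills
  refine Continuous.if_le (by fun_prop) (by fun_prop) continuous_id continuous_const ?_
  rintro x rfl
  exact mills_match _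

/-- The solution has a corner at `z`. A right derivative exists everywhere and suffices for the mean
value inequality; at `z` it sees the right branch, hence the strict `t < z`. -/
lemma hasDerivWithinAt_sol (z t : ℝ) :
    HasDerivWithinAt (sol z)
      (t * sol z t + (if t < z then 1 else 0) - (gaussianReal 0 1).real (Iic z)) (Ici t) t := by
  by_cases h : t < z
  · have h1 := ((hasDerivAt_mills t).const_mul (1 - (gaussianReal 0 1).real (Iic z)))
    have h2 : sol z =ᶠ[𝓝 t] fun w => (1 - (gaussianReal 0 1).real (Iic z)) * mills w := by
      filter_upwards [Iio_mem_nhds h] with w hw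
      rw [sol, if_pos (le_of_lt hw)]
    refine (h1.congr_of_eventuallyEq h2).hasDerivWithinAt.congr_deriv ?_
    rw [if_pos h, sol, if_pos h.le]; ring
  · push Not at h
    have h1 := (((hasDerivAt_mills (-t)).scomp t (hasDerivAt_neg t)).const_mul
      ((gaussianReal 0 1).real (Iic z))).hasDerivWithinAt (s := Ici t)
    have h2 := h1.congr (f₁ := sol z) (fun w hw => by rw [sol_of_ge (h.trans hw)]; rfl)
      (by rw [sol_of_ge h]; rfl)
    refine h2.congr_deriv ?_
    rw [if_neg h.not_gt, sol_of_ge h]; simp; ring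

/-- By Stein's equation, `f'(t) - f'(w)` is an increment of the nondecreasing `w f(w)` plus one of
the nonincreasing indicator. On `[a, b]` both are controlled by their total increments, which add up
to that of `envelope`. -/
lemma abs_sol_sub_le_of_le (z : ℝ) {a b w : ℝ} (hab : a ≤ b) (haw : a ≤ w) (hwb : w ≤ b) :
    |sol z b - sol z a - (b - a) * solDeriv z w| ≤ (b - a) * (envelope z b - envelope z a) := by
  have h := norm_image_sub_le_of_norm_deriv_right_le_segment
    (f := fun t => sol z t - t * solDeriv z w) (a := a) (b := b)
    (f' := fun t => t * sol z t + (if t < z then 1 else 0) - (gaussianReal 0 1).real (Iic z)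
      - 1 * solDeriv z w)
    (C := envelope z b - envelope z a)
    (((continuous_sol z).sub (by fun_prop)).continuousOn)
    (fun t _ => (hasDerivWithinAt_sol z t).sub
      ((hasDerivWithinAt_id t _).mul_const (solDeriv z w)))
    (fun t ht => ?_) b ⟨hab, le_rfl⟩
  · rw [norm_eq_abs] at h
    convert h using 1
    · congr 1; ring
    · ring
  · have m1 := monotone_mul_sol z ht.1
    have m2 := monotone_mul_sol z ht.2.le
    have m3 := monotone_mul_sol z haw
    have m4 := monotone_mul_sol z hwb
    simp only at m1 m2 m3 m4
    have i1 : (if t < z then (1 : ℝ) else 0) ≤ ind z a := by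
      unfold ind; split_ifs with h1 h2 <;> first | (exfalso; linarith [ht.1]) | norm_num
    have i2 : ind z b ≤ if t < z then (1 : ℝ) else 0 := by
      unfold ind; split_ifs with h1 h2 <;> first | (exfalso; linarith [ht.2]) | norm_num
    have i3 : ind z w ≤ ind z a := by
      unfold ind; split_ifs with h1 h2 <;> first | (exfalso; linarith) | norm_num
    have i4 : ind z b ≤ ind z w := by
      unfold ind; split_ifs with h1 h2 <;> first | (exfalso; linarith) | norm_num
    rw [norm_eq_abs, abs_le]
    simp only [solDeriv, envelope]
    constructor <;> linarith

/-- First-order Taylor estimate for the Stein solution, with the remainder controlled by the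
increment of a bounded nondecreasing function. -/
lemma abs_sol_sub_le (z : ℝ) {a b w : ℝ} (hw : w = a ∨ w = b) :
    |sol z b - sol z a - (b - a) * solDeriv z w| ≤ (b - a) * (envelope z b - envelope z a) := by
  rcases le_total a b with hab | hab
  · exact abs_sol_sub_le_of_le z hab (by rcases hw with rfl | rfl <;> linarith)
      (by rcases hw with rfl | rfl <;> linarith)
  · have := abs_sol_sub_le_of_le z (w := w) hab (by rcases hw with rfl | rfl <;> linarith)
      (by rcases hw with rfl | rfl <;> linarith)
    rw [← abs_neg]
    convert this using 1
    · congr 1; ring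
    · ring

end SteinEquation

/-! ### Stein's method on the biased cube. -/

namespace BiasedCube

open Finset SteinEquation

variable {ι : Type*} [DecidableEq ι]

lemma abs_diff_mul_le {j : ι} {F G : Finset ι → ℝ} {a b : ℝ} (hF : ∀ s, |F s| ≤ a)
    (hG : ∀ s, |G s| ≤ a) (hF' : ∀ s, |diff j F s| ≤ b) (hG' : ∀ s, |diff j G s| ≤ b)
    (s : Finset ι) : |diff j (fun t => F t * G t) s| ≤ 2 * a * b := by
  have ha : 0 ≤ a := (abs_nonneg _).trans (hF s)
  have hb : 0 ≤ b := (abs_nonneg _).trans (hF' s)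
  rw [diff_mul]
  calc _ ≤ |diff j F s * G (insert j s)| + |F (s.erase j) * diff j G s| := abs_add_le _ _
    _ = |diff j F s| * |G (insert j s)| + |F (s.erase j)| * |diff j G s| := by
      rw [abs_mul, abs_mul]
    _ ≤ b * a + a * b := add_le_add (mul_le_mul (hF' s) (hG _) (abs_nonneg _) hb)
      (mul_le_mul (hF _) (hG' s) (abs_nonneg _) ha)
    _ = 2 * a * b := by ring

variable [Fintype ι]

/-- Berry–Esseen bound for functions on the biased cube with bounded first and summable second
discrete derivatives. -/
theorem abs_expect_ind_sub_cdf_le {p : ℝ} (h0 : 0 < p) (h1 : p < 1) {F : Finset ι → ℝ}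
    {a β σ : ℝ} {b : ι → ι → ℝ} (ha : 0 ≤ a)
    (hF1 : ∀ j s, |diff j F s| ≤ a) (hF2 : ∀ j k s, |diff k (diff j F) s| ≤ b j k)
    (hb : ∀ j k, b j k ≤ 2 * a) (hβ : ∀ j, ∑ k, b j k ≤ β) (hβ' : ∀ k, ∑ j, b j k ≤ β)
    (hsymm : ∀ j k, b j k = b k j) (hβ0 : 0 ≤ β) (hσ : 0 < σ)
    (hvar : expect p (fun s => (F s - expect p F) ^ 2) = σ ^ 2) (z : ℝ) :
    |expect p (fun s => ind z ((F s - expect p F) / σ)) - (gaussianReal 0 1).real (Set.Iic z)| ≤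
      √(p * (1 - p) * Fintype.card ι) * (a * (2 * a + 20 * (p * (1 - p)) * β)) / σ ^ 2 := by
  set v := p * (1 - p) with hv
  have hv0 : 0 < v := mul_pos h0 (by linarith)
  obtain ⟨H, hH⟩ := exists_isPoissonSol h0 h1 F
  have hH1 : ∀ j s, |diff j H s| ≤ a := fun j s => hH.abs_diff_le h0.le h1.le (hF1 j) s
  have hH2 : ∀ j k s, |diff k (diff j H) s| ≤ b j k := fun j k s =>
    hH.abs_diff_diff_le h0.le h1.le (hF2 j k) s
  have hb0 : ∀ j k, 0 ≤ b j k := fun j k => (abs_nonneg _).trans (hF2 j k ∅)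
  set W : Finset ι → ℝ := fun s => (F s - expect p F) / σ with hW
  have hWd : ∀ j s, diff j W s = diff j F s / σ := fun j s => by
    simp only [diff, hW]; ring
  set T : Finset ι → ℝ := fun s => ∑ j, v / σ ^ 2 * (diff j H s * diff j F s) with hT
  set u : ι → Finset ι → ℝ := fun j s => (1 / σ ^ 2) * (|diff j H s| * diff j F s) with hu
  set N : ℝ := (Fintype.card ι : ℝ) with hN
  have hN0 : 0 ≤ N := Nat.cast_nonneg _
  -- the variance of `T`
  have hET : expect p T = 1 := by
    have h2 := hH.cov_eq fun s => F s - expect p F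
    simp only [← pow_two, hvar, diff_sub_const] at h2
    rw [hT, expect_sum]
    simp only [expect_const_mul, ← mul_sum]
    rw [div_mul_eq_mul_div, ← h2, div_self (by positivity)]
  have hTd : ∀ k s, |diff k T s| ≤ v / σ ^ 2 * (2 * a * β) := by
    intro k s
    rw [hT, diff_sum]
    calc _ ≤ ∑ j, |diff k (fun s => v / σ ^ 2 * (diff j H s * diff j F s)) s| :=
          abs_sum_le_sum_abs _ _
      _ ≤ ∑ j, v / σ ^ 2 * (2 * a * b j k) := by
          refine sum_le_sum fun j _ => ?_
          rw [diff_const_mul, abs_mul, abs_of_pos (by positivity : 0 < v / σ ^ 2)]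
          gcongr
          exact abs_diff_mul_le (hH1 j) (hF1 j) (hH2 j k) (hF2 j k) s
      _ = v / σ ^ 2 * (2 * a * ∑ j, b j k) := by simp only [mul_sum]
      _ ≤ _ := by gcongr; exact hβ' k
  have hTabs : expect p (fun s => |T s - 1|) ≤ √(v * N) * (v / σ ^ 2 * (2 * a * β)) := by
    refine expect_abs_le_of_expect_sq_le h0.le h1.le (by positivity) ?_
    have := variance_le_of_abs_diff_le h0 h1 hTd
    rw [hET] at this
    rw [mul_pow, Real.sq_sqrt (by positivity)]
    linarith
  -- the divergence of `u`
  have hu0 : ∀ j s, diff j (u j) s = 0 := by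
    intro j s
    simp only [hu]
    rw [diff_const_mul]
    simp [diff]
  have hu1 : ∀ j s, |u j s| ≤ 1 / σ ^ 2 * a ^ 2 := by
    intro j s
    rw [hu, abs_mul, abs_mul, abs_abs, abs_of_pos (by positivity : 0 < 1 / σ ^ 2), pow_two a]
    have := hH1 j s
    have := hF1 j s
    gcongr
  have hu2 : ∀ j k s, |diff k (u j) s| ≤ 1 / σ ^ 2 * (2 * a * b j k) := by
    intro j k s
    simp only [hu]
    rw [diff_const_mul, abs_mul, abs_of_pos (by positivity : 0 < 1 / σ ^ 2)]
    gcongr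
    exact abs_diff_mul_le (fun s => by rw [abs_abs]; exact hH1 j s) (hF1 j)
      (fun s => (abs_diff_abs_le _ _ _).trans (hH2 j k s)) (hF2 j k) s
  -- The adjoint of `D` applied to `u`; it moves the derivative off `envelope`.
  set δ : Finset ι → ℝ := fun s => ∑ j, centred p j s * u j s with hδ
  have hδabs : expect p (fun s => |δ s|) ≤ √(v * N) * (1 / σ ^ 2 * (a * (a + 8 * v * β))) := by
    refine expect_abs_le_of_expect_sq_le h0.le h1.le (by positivity) ?_
    rw [hδ, expect_divergence_sq p hu0, ← hv, mul_pow (√(v * N)), Real.sq_sqrt (by positivity)]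
    have e1 : ∑ j, expect p (fun s => u j s ^ 2) ≤ N * (1 / σ ^ 2 * a ^ 2) ^ 2 := by
      rw [hN, ← nsmul_eq_mul, ← card_univ, ← sum_const]
      refine sum_le_sum fun j _ => ?_
      have := expect_mono h0.le h1.le (F := fun s => u j s ^ 2)
        (G := fun _ => (1 / σ ^ 2 * a ^ 2) ^ 2) fun s => by
          rw [← sq_abs (u j s)]; exact pow_le_pow_left₀ (abs_nonneg _) (hu1 j s) 2
      simpa using this
    have e2 : ∑ j, ∑ k, expect p (fun s => diff k (u j) s * diff j (u k) s) ≤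
        N * ((1 / σ ^ 2) ^ 2 * (8 * a ^ 3) * β) := by
      rw [hN, ← nsmul_eq_mul, ← card_univ, ← sum_const]
      refine sum_le_sum fun j _ => ?_
      calc _ ≤ ∑ k, (1 / σ ^ 2) ^ 2 * (8 * a ^ 3) * b j k := by
            refine sum_le_sum fun k _ => ?_
            have := expect_mono h0.le h1.le (F := fun s => diff k (u j) s * diff j (u k) s)
              (G := fun _ => (1 / σ ^ 2) ^ 2 * (8 * a ^ 3) * b j k) fun s => by
                have q1 := hu2 j k s
                have q2 := hu2 k j s
                rw [← hsymm] at q2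
                calc _ ≤ |diff k (u j) s * diff j (u k) s| := le_abs_self _
                  _ = |diff k (u j) s| * |diff j (u k) s| := abs_mul _ _
                  _ ≤ (1 / σ ^ 2 * (2 * a * b j k)) * (1 / σ ^ 2 * (2 * a * b j k)) :=
                    mul_le_mul q1 q2 (abs_nonneg _) ((abs_nonneg _).trans q1)
                  -- One factor `b j k` is sacrificed to the trivial bound `2 * a`, so that only row
                  -- sums of `b` enter.
                  _ ≤ (1 / σ ^ 2 * (2 * a * b j k)) * (1 / σ ^ 2 * (2 * a * (2 * a))) := by
                    have := hb0 j k
                    gcongr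
                    exact hb j k
                  _ = _ := by ring
            simpa using this
        _ = (1 / σ ^ 2) ^ 2 * (8 * a ^ 3) * ∑ k, b j k := by rw [mul_sum]
        _ ≤ _ := by gcongr; exact hβ j
    calc _ ≤ v * (N * (1 / σ ^ 2 * a ^ 2) ^ 2) +
          v ^ 2 * (N * ((1 / σ ^ 2) ^ 2 * (8 * a ^ 3) * β)) := by gcongr
      _ = v * N * ((1 / σ ^ 2) ^ 2 * (a ^ 4 + a ^ 3 * (8 * v * β))) := by ring
      _ ≤ v * N * ((1 / σ ^ 2) ^ 2 * (a ^ 2 * (a + 8 * v * β) ^ 2)) := by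
          gcongr
          have : 0 ≤ a ^ 3 * (8 * v * β) := by positivity
          have : 0 ≤ a ^ 2 * (8 * v * β) ^ 2 := by positivity
          nlinarith
      _ = _ := by ring
  -- Stein's identity
  have hstein : expect p (fun s => W s * sol z (W s)) =
      v / σ * ∑ j, expect p (fun s => diff j H s * diff j (fun t => sol z (W t)) s) := by
    have h2 := hH.cov_eq fun s => sol z (W s)
    have h3 : (fun s => W s * sol z (W s)) =
        fun s => (1 / σ) * ((F s - expect p F) * sol z (W s)) := by
      funext s; simp only [hW]; ring
    rw [h3, expect_const_mul, h2]; ring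
  -- Stein's equation is averaged at `W`, and the linear part of `D_j f(W)` is recognised as `T`.
  have hdec : expect p (fun s => ind z (W s)) - (gaussianReal 0 1).real (Set.Iic z) =
      expect p (fun s => solDeriv z (W s) * (1 - T s)) +
      v / σ * ∑ j, expect p (fun s => diff j H s *
        (diff j W s * solDeriv z (W s) - diff j (fun t => sol z (W t)) s)) := by
    have h2 : expect p (fun s => solDeriv z (W s)) =
        expect p (fun s => W s * sol z (W s)) + expect p (fun s => ind z (W s)) -
          (gaussianReal 0 1).real (Set.Iic z) := by
      simp only [solDeriv]
      rw [expect_sub, expect_add, expect_const]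
    have h3 : expect p (fun s => solDeriv z (W s) * T s) =
        v / σ * ∑ j, expect p (fun s => diff j H s * (diff j W s * solDeriv z (W s))) := by
      rw [mul_sum]
      simp only [← expect_const_mul]
      rw [← expect_sum]
      congr 1; funext s
      rw [hT, mul_sum]
      refine sum_congr rfl fun j _ => ?_
      rw [hWd]; field_simp
    simp only [mul_sub, mul_one, expect_sub, sum_sub_distrib]
    rw [h3, ← hstein, h2]
    ring
  have hrem : |∑ j, expect p (fun s => diff j H s *
      (diff j W s * solDeriv z (W s) - diff j (fun t => sol z (W t)) s))| ≤
      ∑ j, σ * expect p (fun s => u j s * diff j (fun t => envelope z (W t)) s) := by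
    refine (abs_sum_le_sum_abs _ _).trans (sum_le_sum fun j _ => ?_)
    rw [← expect_const_mul]
    refine (abs_expect_le h0.le h1.le _).trans (expect_mono h0.le h1.le fun s => ?_)
    -- The Taylor expansion is taken at the current value `W s`, which is one of the two endpoints
    -- of the increment.
    have hw : W s = W (s.erase j) ∨ W s = W (insert j s) := by
      rcases eq_insert_or_eq_erase j s with h | h
      · right; rw [← h]
      · left; rw [← h]
    have key := abs_sol_sub_le z hw
    rw [abs_mul, abs_sub_comm]
    calc _ ≤ |diff j H s| * (diff j W s * diff j (fun t => envelope z (W t)) s) := by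
          gcongr; exact key
      _ = _ := by rw [hWd]; simp only [hu]; field_simp
  -- Integration by parts in reverse; it applies since `u j` does not depend on the coordinate `j`.
  have hdiv : v * ∑ j, expect p (fun s => u j s * diff j (fun t => envelope z (W t)) s) =
      expect p (fun s => δ s * envelope z (W s)) := by
    simp only [hδ, sum_mul]
    rw [expect_sum, mul_sum]
    refine sum_congr rfl fun j _ => ?_
    have e1 : (fun s => centred p j s * u j s * envelope z (W s)) =
        fun s => centred p j s * (u j s * envelope z (W s)) := by funext s; ring
    rw [e1, expect_centred_mul]
    congr 2; funext s
    rw [diff_mul_of_diff_eq_zero (hu0 j)]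
  have hA : |expect p (fun s => solDeriv z (W s) * (1 - T s))| ≤
      2 * (√(v * N) * (v / σ ^ 2 * (2 * a * β))) := by
    refine (abs_expect_le h0.le h1.le _).trans (le_trans ?_
      (mul_le_mul_of_nonneg_left hTabs zero_le_two))
    rw [← expect_const_mul]
    refine expect_mono h0.le h1.le fun s => ?_
    rw [abs_mul, abs_sub_comm]
    exact mul_le_mul_of_nonneg_right (abs_solDeriv_le _ _) (abs_nonneg _)
  have hB : expect p (fun s => δ s * envelope z (W s)) ≤
      2 * (√(v * N) * (1 / σ ^ 2 * (a * (a + 8 * v * β)))) := by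
    refine (le_abs_self _).trans ((abs_expect_le h0.le h1.le _).trans (le_trans ?_
      (mul_le_mul_of_nonneg_left hδabs zero_le_two)))
    rw [← expect_const_mul]
    refine expect_mono h0.le h1.le fun s => ?_
    rw [abs_mul, mul_comm]
    exact mul_le_mul_of_nonneg_right (abs_envelope_le _ _) (abs_nonneg _)
  rw [hdec]
  refine (abs_add_le _ _).trans ?_
  rw [abs_mul, abs_of_pos (by positivity : 0 < v / σ)]
  have hC := mul_le_mul_of_nonneg_left hrem (by positivity : 0 ≤ v / σ)
  rw [← mul_sum, show ∀ x, v / σ * (σ * x) = v * x by intro x; field_simp, hdiv] at hC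
  calc _ ≤ 2 * (√(v * N) * (v / σ ^ 2 * (2 * a * β))) +
        2 * (√(v * N) * (1 / σ ^ 2 * (a * (a + 8 * v * β)))) := add_le_add hA (hC.trans hB)
    _ = _ := by field_simp; ring

end BiasedCube

/-! ### Functions of the number of chosen coordinates in a fixed set. -/

namespace BiasedCube

open Finset

variable {ι : Type*} [DecidableEq ι]

lemma diff_card_inter (g : ℕ → ℝ) (S : Finset ι) (e : ι) (s : Finset ι) :
    diff e (fun t => g #(t ∩ S)) s =
      if e ∈ S then g (#(s ∩ S.erase e) + 1) - g #(s ∩ S.erase e) else 0 := by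
  have h2 : s.erase e ∩ S = s ∩ S.erase e := by ext x; simp; tauto
  split_ifs with h
  · have h1 : insert e s ∩ S = insert e (s ∩ S.erase e) := by
      ext x; by_cases x = e <;> simp_all
    rw [diff, h1, h2, card_insert_of_notMem (by simp)]
  · have h1 : insert e s ∩ S = s ∩ S := by
      ext x; by_cases x = e <;> simp_all
    rw [diff, h1, h2, erase_eq_of_notMem h, sub_self]

lemma abs_sub_le_one_of_mem {x y : ℝ} (hx : 0 ≤ x ∧ x ≤ 1) (hy : 0 ≤ y ∧ y ≤ 1) :
    |x - y| ≤ 1 :=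
  abs_le.2 ⟨by linarith [hx.1, hy.2], by linarith [hx.2, hy.1]⟩

lemma abs_diff_card_inter_le {g : ℕ → ℝ} (hg : ∀ k, 0 ≤ g k ∧ g k ≤ 1) (S : Finset ι) (e : ι)
    (s : Finset ι) : |diff e (fun t => g #(t ∩ S)) s| ≤ if e ∈ S then 1 else 0 := by
  rw [diff_card_inter]
  split_ifs
  · exact abs_sub_le_one_of_mem (hg _) (hg _)
  · simp

lemma abs_diff_diff_card_inter_le {g : ℕ → ℝ} (hg : ∀ k, 0 ≤ g k ∧ g k ≤ 1) (S : Finset ι)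
    (e f : ι) (s : Finset ι) :
    |diff f (diff e (fun t => g #(t ∩ S))) s| ≤ if e ∈ S ∧ f ∈ S then 2 else 0 := by
  have h1 : ∀ (e f : ι) (s : Finset ι), e ∉ S →
      diff f (diff e (fun t => g #(t ∩ S))) s = 0 := by
    intro e f s he
    have : diff e (fun t => g #(t ∩ S)) = fun _ => 0 := by
      funext t; rw [diff_card_inter, if_neg he]
    rw [this]; simp [diff]
  by_cases he : e ∈ S
  · by_cases hf : f ∈ S
    · rw [if_pos ⟨he, hf⟩]
      have a1 := abs_diff_card_inter_le hg S e (insert f s)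
      have a2 := abs_diff_card_inter_le hg S e (s.erase f)
      rw [if_pos he] at a1 a2
      rw [diff]
      exact (abs_sub _ _).trans (by linarith)
    · rw [diff_comm, h1 f e s hf, if_neg (by tauto), abs_zero]
  · rw [h1 e f s he, if_neg (by tauto), abs_zero]

/-- Expectation of `g` under the binomial distribution with `m` trials. -/
def binomExpect (p : ℝ) : ℕ → (ℕ → ℝ) → ℝ
  | 0, g => g 0
  | m + 1, g => p * binomExpect p m (fun k => g (k + 1)) + (1 - p) * binomExpect p m g

lemma binomExpect_indicator (p : ℝ) (m d : ℕ) :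
    binomExpect p m (fun k => if k = d then 1 else 0) =
      m.choose d * p ^ d * (1 - p) ^ (m - d) := by
  induction m generalizing d with
  | zero => cases d <;> simp [binomExpect]
  | succ m ih =>
    cases d with
    | zero =>
      have h0 : ∀ m : ℕ, binomExpect p m (fun _ => 0) = 0 := by
        intro m; induction m with
        | zero => rfl
        | succ m ih => simp [binomExpect, ih]
      simp [binomExpect, ih, h0, pow_succ']
    | succ d =>
      simp only [binomExpect, Nat.add_right_cancel_iff, ih, Nat.choose_succ_succ, Nat.cast_add,
        Nat.succ_eq_add_one, Nat.add_sub_add_right]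
      -- When `d ≥ m` the exponent `m - (d + 1)` is truncated, but its binomial coefficient
      -- vanishes.
      rcases lt_or_ge d m with h | h
      · rw [show m - d = m - (d + 1) + 1 by omega]; ring
      · rw [Nat.choose_eq_zero_of_lt (by omega : m < d + 1)]; simp; ring

variable [Fintype ι]

lemma expect_card_inter (p : ℝ) (S : Finset ι) (g : ℕ → ℝ) :
    expect p (fun s => g #(s ∩ S)) = binomExpect p #S g := by
  induction S using Finset.induction_on generalizing g with
  | empty => simp [binomExpect]
  | insert e S he ih =>
    have h : resample p e (fun s => g #(s ∩ insert e S)) =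
        fun s => p * g (#(s ∩ S) + 1) + (1 - p) * g #(s ∩ S) := by
      funext s
      have h1 : insert e s ∩ insert e S = insert e (s ∩ S) := by
        ext x; by_cases x = e <;> simp_all
      have h2 : s.erase e ∩ insert e S = s ∩ S := by
        ext x; by_cases x = e <;> simp_all
      rw [resample, h1, h2, card_insert_of_notMem (by simp [he])]
    rw [← expect_resample p e, h, expect_add, expect_const_mul, expect_const_mul, ih,
      ih (fun k => g (k + 1)), card_insert_of_notMem he, binomExpect]

/-- Covariance of two functions that have at most one coordinate in common. -/
lemma cov_eq_of_common_coordinate {p : ℝ} (h0 : 0 < p) (h1 : p < 1) {A B : Finset ι → ℝ} (e : ι)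
    (h : ∀ j, j ≠ e → (∀ s, diff j A s = 0) ∨ (∀ s, diff j B s = 0)) :
    expect p (fun s => (A s - expect p A) * (B s - expect p B)) =
      p * (1 - p) * (expect p (diff e A) * expect p (diff e B)) := by
  obtain ⟨H, hH⟩ := exists_isPoissonSol h0 h1 A
  obtain ⟨K, hK⟩ := exists_isPoissonSol h0 h1 (diff e B)
  have hz : ∀ {F G : Finset ι → ℝ}, IsPoissonSol p F G → ∀ j, (∀ s, diff j F s = 0) →
      ∀ s, diff j G s = 0 := fun hF j hj s => by
    have := hF.abs_diff_le h0.le h1.le (a := 0) (fun s => by rw [hj s, abs_zero]) s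
    simpa using this
  have hzz : ∀ {F : Finset ι → ℝ} {j k : ι}, (∀ s, diff j F s = 0) →
      ∀ s, diff j (diff k F) s = 0 := fun {F j k} hj s => by
    have : diff j F = fun _ => 0 := funext hj
    rw [diff_comm, this]; simp [diff]
  -- Only the shared coordinate survives, since `H` depends on no coordinate that `A` ignores. The
  -- remaining functions `D_e H` and `D_e B` share no coordinate, so the covariance formula applied
  -- to `K` shows that they are uncorrelated.
  rw [hH.cov_eq, sum_eq_single e]
  · have h2 := hK.cov_eq (diff e H)
    rw [sum_eq_zero] at h2
    · have h3 : expect p (fun s => (diff e B s - expect p (diff e B)) * diff e H s) =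
          expect p (fun s => diff e H s * diff e B s) -
            expect p (diff e B) * expect p (diff e H) := by
        rw [← expect_const_mul, ← expect_sub]; congr 1; funext s; ring
      rw [h3, hH.expect_diff, mul_zero] at h2
      simp only [diff_sub_const]
      rw [sub_eq_zero.1 h2]; ring
    · intro j _
      have : ∀ s, diff j K s * diff j (diff e H) s = 0 := by
        intro s
        by_cases hj : j = e
        · subst hj; simp
        rcases h j hj with hA | hB
        · rw [hzz (hz hH j hA)]; simp
        · rw [hz hK j (hzz hB)]; simp
      simp [this]
  · intro j _ hj
    have : ∀ s, diff j H s * diff j (fun s => B s - expect p B) s = 0 := by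
      intro s
      rw [diff_sub_const]
      rcases h j hj with hA | hB
      · rw [hz hH j hA]; simp
      · rw [hB]; simp
    simp [this]
  · simp

end BiasedCube

/-! ### Edge sets of graphs -/

namespace EdgeCube

open Finset BiasedCube

variable {V : Type*} [Fintype V] [DecidableEq V]

/-- The pairs of distinct vertices. -/
abbrev Edge (V : Type*) := {e : Sym2 V // ¬e.IsDiag}

/-- The pairs containing a vertex. -/
def star (v : V) : Finset (Edge V) := univ.filter fun e => v ∈ e.1

@[simp] lemma mem_star {v : V} {e : Edge V} : e ∈ star v ↔ v ∈ e.1 := by simp [star]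

lemma card_star (v : V) : #(star v) = Fintype.card V - 1 := by
  rw [← card_univ, ← card_erase_of_mem (mem_univ v)]
  symm
  refine card_bij (fun w hw => ⟨s(v, w), by simpa using (ne_of_mem_erase hw).symm⟩) ?_ ?_ ?_
  · intro w hw; simp
  · intro w hw w' hw' h
    exact Sym2.congr_right.1 (Subtype.ext_iff.1 h)
  · rintro ⟨e, he⟩ h
    obtain ⟨w, rfl⟩ := Sym2.mem_iff_exists.1 (mem_star.1 h)
    exact ⟨w, by simpa [eq_comm] using he, rfl⟩

lemma card_endpoints (e : Edge V) : #(univ.filter fun v => e ∈ star v) = 2 := by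
  obtain ⟨e, he⟩ := e
  induction e using Sym2.ind with
  | _ x y =>
    rw [Sym2.mk_isDiag_iff] at he
    rw [← card_pair he]; congr 1; ext z; simp

lemma eq_of_mem_star {u v : V} (huv : u ≠ v) {e : Edge V} (hu : e ∈ star u) (hv : e ∈ star v) :
    e.1 = s(u, v) :=
  (Sym2.mem_and_mem_iff huv).1 ⟨mem_star.1 hu, mem_star.1 hv⟩

/-- The sum over the vertices of a function of the degree. -/
def degSum (g : ℕ → ℝ) (s : Finset (Edge V)) : ℝ := ∑ v, g #(s ∩ star v)

lemma diff_degSum (g : ℕ → ℝ) (e : Edge V) :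
    diff e (degSum g) =
      fun s => ∑ v, diff e (fun t => g #(t ∩ star v)) s :=
  funext fun s => diff_sum _ _ _ s

lemma abs_diff_degSum_le {g : ℕ → ℝ} (hg : ∀ k, 0 ≤ g k ∧ g k ≤ 1) (e : Edge V)
    (s : Finset (Edge V)) : |diff e (degSum g) s| ≤ 2 := by
  rw [diff_degSum]
  calc _ ≤ ∑ v, |diff e (fun t => g #(t ∩ star v)) s| := abs_sum_le_sum_abs _ _
    _ ≤ ∑ v, if e ∈ star v then (1 : ℝ) else 0 :=
      sum_le_sum fun v _ => abs_diff_card_inter_le hg _ _ _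
    _ = 2 := by rw [sum_boole, card_endpoints]; norm_num

/-- Twice the number of common endpoints. -/
def overlap (e f : Edge V) : ℝ := ∑ v, if e ∈ star v ∧ f ∈ star v then 2 else 0

lemma overlap_comm (e f : Edge V) : overlap e f = overlap f e := by
  simp only [overlap, and_comm]

lemma overlap_le (e f : Edge V) : overlap e f ≤ 2 * 2 := by
  calc overlap e f ≤ ∑ v, if e ∈ star v then (2 : ℝ) else 0 := by
        refine sum_le_sum fun v _ => ?_
        split_ifs <;> first | tauto | norm_num
    _ = 2 * 2 := by rw [← sum_filter, sum_const, card_endpoints]; norm_num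

/-- Exchanging the sums, each of the two endpoints of `e` contributes twice the size of its star. -/
lemma sum_overlap_le (e : Edge V) : ∑ f, overlap e f ≤ 4 * Fintype.card V := by
  unfold overlap
  rw [sum_comm]
  calc _ = ∑ v, if e ∈ star v then (2 * #(star v) : ℝ) else 0 := by
        refine sum_congr rfl fun v _ => ?_
        by_cases h : e ∈ star v
        · simp only [h, true_and, if_true]
          rw [← sum_filter, sum_const, filter_mem_eq_inter, univ_inter, nsmul_eq_mul]; ring
        · simp [h]
    _ ≤ ∑ v, if e ∈ star v then (2 * Fintype.card V : ℝ) else 0 := by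
        refine sum_le_sum fun v _ => ?_
        split_ifs
        · rw [card_star]; gcongr; omega
        · rfl
    _ = 4 * Fintype.card V := by
        rw [← sum_filter, sum_const, card_endpoints]; simp; ring

lemma abs_diff_diff_degSum_le {g : ℕ → ℝ} (hg : ∀ k, 0 ≤ g k ∧ g k ≤ 1) (e f : Edge V)
    (s : Finset (Edge V)) :
    |diff f (diff e (degSum g)) s| ≤ overlap e f := by
  rw [diff_degSum, diff_sum]
  exact (abs_sum_le_sum_abs _ _).trans
    (sum_le_sum fun v _ => abs_diff_diff_card_inter_le hg _ _ _ _)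

lemma card_edge_le : (Fintype.card (Edge V) : ℝ) ≤ (Fintype.card V : ℝ) ^ 2 := by
  rw [Sym2.card_subtype_not_diag]
  exact_mod_cast Nat.choose_le_pow _ _

/-- Berry–Esseen bound for sums of a bounded function of the degrees. -/
theorem abs_expect_degSum_sub_cdf_le {p K σ : ℝ} (h0 : 0 < p) (h1 : p < 1)
    (hK : Fintype.card V * p ≤ K) {g : ℕ → ℝ} (hg : ∀ k, 0 ≤ g k ∧ g k ≤ 1) (hσ : 0 < σ)
    (hvar : expect p (fun s : Finset (Edge V) => (degSum g s - expect p (degSum g : Finset (Edge V) → ℝ)) ^ 2) = σ ^ 2)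
    (z : ℝ) :
    |expect p (fun s : Finset (Edge V) =>
      SteinEquation.ind z ((degSum g s - expect p (degSum g : Finset (Edge V) → ℝ)) / σ)) -
        (gaussianReal 0 1).real (Set.Iic z)| ≤
      (8 + 160 * K) * (Fintype.card V * √p / σ ^ 2) := by
  have hV : (0 : ℝ) ≤ Fintype.card V := Nat.cast_nonneg _
  -- Two endpoints per edge give `a = 2`, and `sum_overlap_le` gives `β`. As `vβ ≤ 4K`, the constant
  -- is `2 * (2 * 2 + 20 * (4 * K)) = 8 + 160 * K`.
  refine (abs_expect_ind_sub_cdf_le h0 h1 (a := 2) (β := 4 * Fintype.card V) (b := overlap)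
    (by norm_num) (abs_diff_degSum_le hg) (abs_diff_diff_degSum_le hg) overlap_le
    sum_overlap_le (fun k => ?_) overlap_comm (by positivity) hσ hvar z).trans ?_
  · simp only [overlap_comm _ k]; exact sum_overlap_le k
  · have e1 : √(p * (1 - p) * Fintype.card (Edge V)) ≤ Fintype.card V * √p := by
      rw [Real.sqrt_le_left (by positivity), mul_pow, Real.sq_sqrt h0.le]
      have := card_edge_le (V := V)
      calc p * (1 - p) * Fintype.card (Edge V) ≤ p * 1 * (Fintype.card V : ℝ) ^ 2 := by
            gcongr; linarith
        _ = _ := by ring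
    have e2 : p * (1 - p) * (4 * Fintype.card V) ≤ 4 * K := by
      have : p * (1 - p) * (4 * Fintype.card V) ≤ p * 1 * (4 * Fintype.card V) := by
        gcongr; linarith
      linarith
    have e3 : 0 ≤ p * (1 - p) * (4 * Fintype.card V : ℝ) := by
      have : 0 ≤ 1 - p := by linarith
      positivity
    calc _ ≤ Fintype.card V * √p * (2 * (2 * 2 + 20 * (4 * K))) / σ ^ 2 := by
          have e4 : 20 * (p * (1 - p)) * (4 * Fintype.card V : ℝ) ≤ 20 * (4 * K) := by linarith
          gcongr
      _ = _ := by ring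

/-- The variance of the number of vertices of degree `d` is at least that in the independent
case. -/
lemma le_variance_degSum {p : ℝ} (h0 : 0 < p) (h1 : p < 1) (d : ℕ) :
    Fintype.card V *
      (binomExpect p (Fintype.card V - 1) (fun k => if k = d then 1 else 0) *
        (1 - binomExpect p (Fintype.card V - 1) (fun k => if k = d then 1 else 0))) ≤
    expect p (fun s : Finset (Edge V) => (degSum (fun k => if k = d then 1 else 0) s -
      expect p (degSum (fun k => if k = d then 1 else 0) : Finset (Edge V) → ℝ)) ^ 2) := by
  set g : ℕ → ℝ := fun k => if k = d then 1 else 0 with hg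
  set π := binomExpect p (Fintype.card V - 1) g with hπ
  set A : V → Finset (Edge V) → ℝ := fun v s => g #(s ∩ star v) with hA
  have hEA : ∀ v, expect p (A v) = π := fun v => by
    rw [hA, expect_card_inter, card_star]
  have hsum : (fun s : Finset (Edge V) => (degSum g s - expect p (degSum g : Finset (Edge V) → ℝ)) ^ 2) =
      fun s => ∑ u, ∑ v, (A u s - expect p (A u)) * (A v s - expect p (A v)) := by
    have e1 : expect p (degSum g : Finset (Edge V) → ℝ) = ∑ v, expect p (A v) :=
      expect_sum univ p A
    funext s
    rw [e1, show degSum g s = ∑ v, A v s from rfl, ← sum_sub_distrib, pow_two, sum_mul_sum]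
  -- The pair `s(u, v)` is the only coordinate common to both stars, and the two mean derivatives
  -- there coincide, so the covariance is `p(1-p)` times a square.
  have hcov : ∀ u v, u ≠ v →
      0 ≤ expect p (fun s => (A u s - expect p (A u)) * (A v s - expect p (A v))) := by
    intro u v huv
    let e : Edge V := ⟨s(u, v), by simpa using huv⟩
    have hD : ∀ w, e ∈ star w → expect p (diff e (A w)) =
        binomExpect p (Fintype.card V - 1 - 1) (fun k => g (k + 1) - g k) := by
      intro w hw
      have : diff e (A w) =
          fun s => (fun k => g (k + 1) - g k) #(s ∩ (star w).erase e) := by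
        funext s; rw [hA, diff_card_inter, if_pos hw]
      rw [this, expect_card_inter p _ (fun k => g (k + 1) - g k), card_erase_of_mem hw, card_star]
    rw [cov_eq_of_common_coordinate h0 h1 e, hD u (by simp [e]), hD v (by simp [e])]
    · exact mul_nonneg (mul_nonneg h0.le (by linarith)) (mul_self_nonneg _)
    · intro j hj
      by_cases hu : j ∈ star u
      · right
        intro s
        rw [hA, diff_card_inter, if_neg]
        exact fun hv => hj (Subtype.ext (eq_of_mem_star huv hu hv))
      · left
        intro s
        rw [hA, diff_card_inter, if_neg hu]
  have hdiag : ∀ v, expect p (fun s => (A v s - expect p (A v)) * (A v s - expect p (A v))) =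
      π * (1 - π) := by
    intro v
    have : (fun s => (A v s - expect p (A v)) * (A v s - expect p (A v))) =
        fun s => (1 - 2 * π) * A v s + π ^ 2 := by
      funext s
      have : A v s * A v s = A v s := by simp [hA, hg]
      rw [hEA]; linear_combination this
    rw [this, expect_add, expect_const_mul, BiasedCube.expect_const, hEA]; ring
  rw [hsum, expect_sum]
  simp only [expect_sum]
  calc _ = ∑ _u : V, π * (1 - π) := by simp
    _ ≤ _ := by
      refine sum_le_sum fun u _ => ?_
      rw [← hdiag u]
      refine single_le_sum (f := fun v => expect p
        (fun s => (A u s - expect p (A u)) * (A v s - expect p (A v)))) (fun v _ => ?_) (mem_univ u)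
      by_cases h : u = v
      · subst h
        have := expect_mono h0.le h1.le (F := fun _ : Finset (Edge V) => (0 : ℝ))
          (G := fun s => (A u s - expect p (A u)) * (A u s - expect p (A u)))
          (fun s => mul_self_nonneg _)
        simpa using this
      · exact hcov u v h

end EdgeCube

/-! ### Transfer to the Erdős–Rényi graph -/

namespace EdgeCube

open Finset BiasedCube

variable {V : Type*} [Fintype V] [DecidableEq V]

open Classical in
/-- Sets of pairs of distinct vertices correspond to graphs. -/
noncomputable def toGraph : Finset (Edge V) ≃ SimpleGraph V where
  toFun s := SimpleGraph.fromEdgeSet (Subtype.val '' (s : Set (Edge V)))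
  invFun G := univ.filter fun e => e.1 ∈ G.edgeSet
  left_inv s := by
    ext e
    have := e.2
    simp [SimpleGraph.edgeSet_fromEdgeSet, this]
  right_inv G := by
    have : Subtype.val '' ((univ.filter fun e : Edge V => e.1 ∈ G.edgeSet : Finset (Edge V)) :
        Set (Edge V)) = G.edgeSet := by
      ext e
      simp only [coe_filter, mem_univ, true_and, Set.mem_image, Subtype.exists]
      constructor
      · rintro ⟨e, _, he, rfl⟩; exact he
      · intro he; exact ⟨e, G.not_isDiag_of_mem_edgeSet he, he, rfl⟩
    exact (congrArg SimpleGraph.fromEdgeSet this).trans (SimpleGraph.fromEdgeSet_edgeSet G)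

lemma edgeSet_toGraph (s : Finset (Edge V)) :
    (toGraph s).edgeSet = Subtype.val '' (s : Set (Edge V)) := by
  rw [toGraph, Equiv.coe_fn_mk, SimpleGraph.edgeSet_fromEdgeSet]
  ext e
  simp only [Set.mem_sdiff, Set.mem_image, mem_coe]
  constructor
  · exact fun h => h.1
  · rintro ⟨e, he, rfl⟩; exact ⟨⟨e, he, rfl⟩, e.2⟩

open Classical in
lemma degree_toGraph (s : Finset (Edge V)) (v : V) : (toGraph s).degree v = #(s ∩ star v) := by
  rw [← SimpleGraph.card_incidenceFinset_eq_degree]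
  symm
  refine card_bij (fun e _ => e.1) ?_ ?_ ?_
  · intro e he
    rw [SimpleGraph.mem_incidenceFinset, SimpleGraph.incidenceSet, edgeSet_toGraph]
    rw [mem_inter, mem_star] at he
    exact ⟨⟨e, he.1, rfl⟩, he.2⟩
  · intro e _ f _ h; exact Subtype.ext h
  · intro e he
    rw [SimpleGraph.mem_incidenceFinset, SimpleGraph.incidenceSet, edgeSet_toGraph] at he
    obtain ⟨⟨f, hf, rfl⟩, hv⟩ := he
    exact ⟨f, mem_inter.2 ⟨hf, mem_star.2 hv⟩, rfl⟩

lemma numVerticesOfDegree_toGraph (d n : ℕ) (s : Finset (Edge (Fin n))) :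
    numVerticesOfDegree d n (toGraph s) = degSum (fun k => if k = d then 1 else 0) s := by
  classical
  rw [numVerticesOfDegree, degSum, ← sum_boole]
  refine sum_congr rfl fun v _ => ?_
  rw [← degree_toGraph]

/-- Lets integrals against `erdosRenyi` be computed as finite weighted sums over graphs. -/
instance (n : ℕ) : MeasurableSingletonClass (SimpleGraph (Fin n)) where
  measurableSet_singleton G := by
    have : {G} = SimpleGraph.edgeSet ⁻¹' {G.edgeSet} := by
      ext H; simp
    rw [this]
    exact SimpleGraph.measurableEmbedding_edgeSet.measurable (measurableSet_singleton _)

instance (n : ℕ) (p : unitInterval) : IsProbabilityMeasure (erdosRenyi n p) :=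
  inferInstanceAs (IsProbabilityMeasure (SimpleGraph.binomialRandom (Fin n) p))

lemma integral_erdosRenyi (n : ℕ) (p : unitInterval) (f : SimpleGraph (Fin n) → ℝ) :
    ∫ G, f G ∂(erdosRenyi n p) = BiasedCube.expect (p : ℝ) fun s => f (toGraph s) := by
  classical
  rw [integral_fintype .of_finite, BiasedCube.expect, ← toGraph.sum_comp]
  refine sum_congr rfl fun s _ => ?_
  have h1 : (toGraph s).edgeSet.ncard = #s := by
    rw [edgeSet_toGraph, Set.ncard_image_of_injective _ Subtype.val_injective,
      Set.ncard_coe_finset]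
  rw [erdosRenyi, measureReal_def, SimpleGraph.binomialRandom_singleton, h1,
    Sym2.card_subtype_not_diag, Nat.card_eq_fintype_card, smul_eq_mul]
  simp

lemma variance_numVerticesOfDegree (d n : ℕ) (p : unitInterval) :
    variance (numVerticesOfDegree d n) (erdosRenyi n p) =
      BiasedCube.expect (p : ℝ) fun s : Finset (Edge (Fin n)) =>
        (degSum (fun k => if k = d then 1 else 0) s - BiasedCube.expect (p : ℝ)
          (degSum (fun k => if k = d then 1 else 0) : Finset (Edge (Fin n)) → ℝ)) ^ 2 := by
  rw [variance_eq_integral (Measurable.of_discrete).aemeasurable, integral_erdosRenyi,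
    integral_erdosRenyi]
  simp only [numVerticesOfDegree_toGraph]

/-- Berry–Esseen bound for the number of vertices of degree `d`. -/
theorem kolmogorovDist_normalizedDegreeCount_le {Ω : Type*} [MeasurableSpace Ω] {P : Measure Ω}
    {N : Ω → ℝ} (hN : HasLaw N (gaussianReal 0 1) P) {d n : ℕ} {p : unitInterval} {K : ℝ}
    (h0 : 0 < (p : ℝ)) (h1 : (p : ℝ) < 1) (hK : n * (p : ℝ) ≤ K)
    (hvar : 0 < variance (numVerticesOfDegree d n) (erdosRenyi n p)) :
    kolmogorovDist (normalizedDegreeCount d n p) (erdosRenyi n p) N P ≤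
      (8 + 160 * K) *
        (n * √(p : ℝ) / variance (numVerticesOfDegree d n) (erdosRenyi n p)) := by
  refine ciSup_le fun z => ?_
  have hσ := Real.sqrt_pos.2 hvar
  have hg : ∀ k : ℕ, (0 : ℝ) ≤ (if k = d then 1 else 0) ∧ (if k = d then (1 : ℝ) else 0) ≤ 1 :=
    fun k => by split_ifs <;> norm_num
  have hsq : BiasedCube.expect (p : ℝ) (fun s : Finset (Edge (Fin n)) =>
      (degSum (fun k => if k = d then 1 else 0) s - BiasedCube.expect (p : ℝ)
        (degSum (fun k => if k = d then 1 else 0) : Finset (Edge (Fin n)) → ℝ)) ^ 2) =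
      √(variance (numVerticesOfDegree d n) (erdosRenyi n p)) ^ 2 := by
    rw [Real.sq_sqrt hvar.le, variance_numVerticesOfDegree]
  have key := abs_expect_degSum_sub_cdf_le (V := Fin n) h0 h1 (by simpa using hK) hg hσ hsq z
  rw [Real.sq_sqrt hvar.le, Fintype.card_fin] at key
  have hNz : P.real {ω | N ω ≤ z} = (gaussianReal 0 1).real (Set.Iic z) :=
    hN.measureReal_eq measurableSet_Iic
  have hX : (erdosRenyi n p).real {G | normalizedDegreeCount d n p G ≤ z} =
      BiasedCube.expect (p : ℝ) (fun s : Finset (Edge (Fin n)) =>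
        SteinEquation.ind z ((degSum (fun k => if k = d then 1 else 0) s - BiasedCube.expect (p : ℝ)
        (degSum (fun k => if k = d then 1 else 0) : Finset (Edge (Fin n)) → ℝ)) /
          √(variance (numVerticesOfDegree d n) (erdosRenyi n p)))) := by
    rw [← integral_indicator_one (MeasurableSet.of_discrete), integral_erdosRenyi]
    congr 1; funext s
    have hE : ∫ H, numVerticesOfDegree d n H ∂(erdosRenyi n p) = BiasedCube.expect (p : ℝ)
        (degSum (fun k => if k = d then 1 else 0) : Finset (Edge (Fin n)) → ℝ) := by
      rw [integral_erdosRenyi]; simp only [numVerticesOfDegree_toGraph]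
    rw [← hE, ← numVerticesOfDegree_toGraph]
    simp only [Set.indicator, Set.mem_ofPred_eq, SteinEquation.ind, normalizedDegreeCount,
      Pi.one_apply]
    congr
  rw [hX, hNz]
  exact key

lemma le_variance_numVerticesOfDegree (d n : ℕ) {p : unitInterval} (h0 : 0 < (p : ℝ))
    (h1 : (p : ℝ) < 1) :
    n * (((n - 1).choose d * (p : ℝ) ^ d * (1 - (p : ℝ)) ^ (n - 1 - d)) *
      (1 - (n - 1).choose d * (p : ℝ) ^ d * (1 - (p : ℝ)) ^ (n - 1 - d))) ≤
      variance (numVerticesOfDegree d n) (erdosRenyi n p) := by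
  have := le_variance_degSum (V := Fin n) h0 h1 d
  rw [variance_numVerticesOfDegree]
  simpa only [Fintype.card_fin, binomExpect_indicator] using this

end EdgeCube

/-! ### Variance and rate of convergence -/

namespace EdgeCube

lemma exp_le_one_sub_pow {p K : ℝ} {m : ℕ} (h0 : 0 ≤ p) (h2 : p ≤ 1 / 2) (hK : m * p ≤ K) :
    Real.exp (-2 * K) ≤ (1 - p) ^ m := by
  -- From `e^{2p} ≥ 1 + 2p` and `(1 - p)(1 + 2p) ≥ 1` for `0 ≤ p ≤ 1/2`.
  have h1 : Real.exp (-2 * p) ≤ 1 - p := by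
    have h3 : Real.exp (-2 * p) * Real.exp (2 * p) = 1 := by
      rw [← Real.exp_add, ← Real.exp_zero]; congr 1; ring
    have h4 := Real.add_one_le_exp (2 * p)
    have h5 := Real.exp_pos (-2 * p)
    nlinarith
  calc Real.exp (-2 * K) ≤ Real.exp (m * (-2 * p)) := by
        apply Real.exp_le_exp.2; linarith
    _ = Real.exp (-2 * p) ^ m := by rw [Real.exp_nat_mul]
    _ ≤ _ := pow_le_pow_left₀ (Real.exp_pos _).le h1 m

lemma one_sub_pow_mul_le_one {p : ℝ} (m : ℕ) (h0 : 0 ≤ p) (h1 : p ≤ 1) :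
    (1 - p) ^ m * (1 + m * p) ≤ 1 := by
  have hq : 0 ≤ 1 - p := by linarith
  calc (1 - p) ^ m * (1 + m * p) ≤ (1 - p) ^ m * (1 + p) ^ m := by
        gcongr
        exact one_add_mul_le_pow (by linarith) m
    _ = (1 - p ^ 2) ^ m := by rw [← mul_pow]; ring
    _ ≤ 1 := pow_le_one₀ (by nlinarith) (by nlinarith)

/-- Here `π = (1-p)^{n-1}` is bounded below, while `1 - π` may be as small as order `np`;
Bernoulli's inequality shows it is no smaller. -/
lemma le_variance_isolated {n : ℕ} {p : unitInterval} {K : ℝ} (h0 : 0 < (p : ℝ))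
    (h2 : (p : ℝ) ≤ 1 / 2) (hK : n * (p : ℝ) ≤ K) (hn : 2 ≤ n) :
    Real.exp (-2 * K) / (2 * (1 + K)) * ((n : ℝ) ^ 2 * p) ≤
      variance (numVerticesOfDegree 0 n) (erdosRenyi n p) := by
  refine le_trans ?_ (le_variance_numVerticesOfDegree 0 n h0 (by linarith))
  simp only [Nat.choose_zero_right, Nat.cast_one, pow_zero, one_mul, Nat.sub_zero]
  set m := n - 1 with hm
  have hmn : (n : ℝ) = m + 1 := by
    rw [show n = m + 1 by omega]; push_cast; ring
  have hm1 : (1 : ℝ) ≤ m := by exact_mod_cast (by omega : 1 ≤ m)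
  have hmp : m * (p : ℝ) ≤ K := by nlinarith
  have hmp0 : 0 ≤ m * (p : ℝ) := by positivity
  have hK0 : 0 ≤ K := hmp0.trans hmp
  have e1 := exp_le_one_sub_pow h0.le h2 hmp
  have e2 := one_sub_pow_mul_le_one m h0.le (by linarith)
  set Q := (1 - (p : ℝ)) ^ m with hQ
  have hQ0 : 0 ≤ Q := (Real.exp_pos _).le.trans e1
  have e3 : m * (p : ℝ) / (1 + K) ≤ 1 - Q := by
    have h3 : Q ≤ 1 / (1 + m * (p : ℝ)) := by
      rw [le_div_iff₀ (by positivity)]; exact e2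
    calc m * (p : ℝ) / (1 + K) ≤ m * (p : ℝ) / (1 + m * (p : ℝ)) := by gcongr
      _ = 1 - 1 / (1 + m * (p : ℝ)) := by field_simp; ring
      _ ≤ _ := by linarith
  calc _ = n * (Real.exp (-2 * K) * ((n : ℝ) / 2 * p / (1 + K))) := by field_simp
    _ ≤ n * (Real.exp (-2 * K) * (m * p / (1 + K))) := by gcongr; linarith
    _ ≤ _ := by gcongr

/-- Here `π` is of order at least `(np)^d`, while `1 - π` is at least the probability of degree zero
and so stays away from zero. -/
lemma le_variance_degree {n d : ℕ} {p : unitInterval} {K : ℝ} (h0 : 0 < (p : ℝ))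
    (h2 : (p : ℝ) ≤ 1 / 2) (hK : n * (p : ℝ) ≤ K) (hd : 1 ≤ d) (hn : 2 * d ≤ n) :
    Real.exp (-2 * K) ^ 2 / (2 ^ d * d.factorial) * (n * (n * (p : ℝ)) ^ d) ≤
      variance (numVerticesOfDegree d n) (erdosRenyi n p) := by
  refine le_trans ?_ (le_variance_numVerticesOfDegree d n h0 (by linarith))
  set m := n - 1 with hm
  have hq : 0 < 1 - (p : ℝ) := by linarith
  have hmn : (m : ℝ) ≤ n := by exact_mod_cast (by omega : m ≤ n)
  have e1 : Real.exp (-2 * K) ≤ (1 - (p : ℝ)) ^ m :=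
    exp_le_one_sub_pow h0.le h2 (by nlinarith)
  have e2 : Real.exp (-2 * K) ≤ (1 - (p : ℝ)) ^ (m - d) := by
    refine exp_le_one_sub_pow h0.le h2 ?_
    have : ((m - d : ℕ) : ℝ) ≤ n := by exact_mod_cast (by omega : m - d ≤ n)
    nlinarith
  have e3 : ((n : ℝ) / 2) ^ d / d.factorial ≤ m.choose d := by
    refine le_trans ?_ (Nat.pow_le_choose d m)
    -- Since `m + 1 = n`, this is where `2 * d ≤ n` enters.
    have : (n : ℝ) / 2 ≤ ((m + 1 - d : ℕ) : ℝ) := by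
      rw [div_le_iff₀ two_pos]
      exact_mod_cast (by omega : n ≤ (m + 1 - d) * 2)
    gcongr
  -- Two distinct terms of the binomial expansion of `(p + (1 - p))^m`; they are distinct because `d
  -- ≥ 1`.
  have e4 : (m.choose d * (p : ℝ) ^ d * (1 - (p : ℝ)) ^ (m - d)) + (1 - (p : ℝ)) ^ m ≤ 1 := by
    have h3 := add_pow (p : ℝ) (1 - p) m
    rw [add_sub_cancel, one_pow] at h3
    have h4 : ({d, 0} : Finset ℕ) ⊆ Finset.range (m + 1) := by
      intro k hk
      simp only [Finset.mem_insert, Finset.mem_singleton] at hk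
      rw [Finset.mem_range]; omega
    refine le_trans (le_of_eq ?_)
      ((Finset.sum_le_sum_of_subset_of_nonneg h4 fun k _ _ => ?_).trans_eq h3.symm)
    · rw [Finset.sum_pair (by omega)]; simp; ring
    · positivity
  have e5 : ((n : ℝ) / 2) ^ d / d.factorial * (p : ℝ) ^ d * Real.exp (-2 * K) ≤
      m.choose d * (p : ℝ) ^ d * (1 - (p : ℝ)) ^ (m - d) := by gcongr
  set π := m.choose d * (p : ℝ) ^ d * (1 - (p : ℝ)) ^ (m - d) with hπ
  calc _ = n * ((((n : ℝ) / 2) ^ d / d.factorial * (p : ℝ) ^ d * Real.exp (-2 * K)) *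
        Real.exp (-2 * K)) := by rw [div_pow, mul_pow]; field_simp
    _ ≤ n * (π * (1 - π)) := by
      have : Real.exp (-2 * K) ≤ 1 - π := by linarith
      have : 0 ≤ π := by positivity
      gcongr

lemma kolmogorovDist_nonneg {Ω Ω' : Type*} [MeasurableSpace Ω] [MeasurableSpace Ω']
    (X : Ω → ℝ) (P : Measure Ω) (Y : Ω' → ℝ) (Q : Measure Ω') : 0 ≤ kolmogorovDist X P Y Q :=
  Real.iSup_nonneg fun _ => abs_nonneg _

section Rates

variable {Ω : Type*} [MeasurableSpace Ω] {P : Measure Ω} {N : Ω → ℝ}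

lemma kolmogorovDist_isolated_le (hN : HasLaw N (gaussianReal 0 1) P) {K : ℝ} (hK0 : 0 ≤ K) :
    ∃ C : ℝ, 0 ≤ C ∧ ∀ (n : ℕ) (p : unitInterval), 0 < (p : ℝ) → (p : ℝ) ≤ 1 / 2 →
      n * (p : ℝ) ≤ K → 2 ≤ n →
      kolmogorovDist (normalizedDegreeCount 0 n p) (erdosRenyi n p) N P ≤
        C * ((n : ℝ)⁻¹ * (√(p : ℝ))⁻¹) := by
  refine ⟨(8 + 160 * K) * (Real.exp (-2 * K) / (2 * (1 + K)))⁻¹, by positivity,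
    fun n p h0 h2 hK hn => ?_⟩
  have hv := le_variance_isolated h0 h2 hK hn
  have hn0 : (0 : ℝ) < n := by exact_mod_cast (by omega : 0 < n)
  have hp := Real.sqrt_pos.2 h0
  have hc : 0 < Real.exp (-2 * K) / (2 * (1 + K)) := by positivity
  set c := Real.exp (-2 * K) / (2 * (1 + K))
  refine (kolmogorovDist_normalizedDegreeCount_le hN h0 (by linarith) hK
    (lt_of_lt_of_le (by positivity) hv)).trans ?_
  rw [mul_assoc]
  gcongr
  calc _ ≤ n * √(p : ℝ) / (c * ((n : ℝ) ^ 2 * p)) := by gcongr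
    _ = n * √(p : ℝ) / (c * ((n : ℝ) ^ 2 * √(p : ℝ) ^ 2)) := by rw [Real.sq_sqrt h0.le]
    _ = _ := by field_simp

lemma kolmogorovDist_degree_le (hN : HasLaw N (gaussianReal 0 1) P) {K : ℝ} (hK0 : 0 ≤ K) {d : ℕ}
    (hd : 1 ≤ d) :
    ∃ C : ℝ, 0 ≤ C ∧ ∀ (n : ℕ) (p : unitInterval), 0 < (p : ℝ) → (p : ℝ) ≤ 1 / 2 →
      n * (p : ℝ) ≤ K → 2 * d ≤ n →
      kolmogorovDist (normalizedDegreeCount d n p) (erdosRenyi n p) N P ≤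
        C * (((n * (p : ℝ)) ^ d)⁻¹ * √(p : ℝ)) := by
  refine ⟨(8 + 160 * K) * (Real.exp (-2 * K) ^ 2 / (2 ^ d * d.factorial))⁻¹, by positivity,
    fun n p h0 h2 hK hn => ?_⟩
  have hv := le_variance_degree h0 h2 hK hd hn
  have hn0 : (0 : ℝ) < n := by exact_mod_cast (by omega : 0 < n)
  have hc : 0 < Real.exp (-2 * K) ^ 2 / (2 ^ d * d.factorial) := by positivity
  set c := Real.exp (-2 * K) ^ 2 / (2 ^ d * d.factorial)
  refine (kolmogorovDist_normalizedDegreeCount_le hN h0 (by linarith) hK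
    (lt_of_lt_of_le (by positivity) hv)).trans ?_
  rw [mul_assoc]
  gcongr
  calc _ ≤ n * √(p : ℝ) / (c * (n * (n * (p : ℝ)) ^ d)) := by gcongr
    _ = _ := by field_simp

variable {p : ℕ → unitInterval}

lemma exists_sparse_bound
    (hnp : (fun n : ℕ => (n : ℝ) * (p n : ℝ)) =O[atTop] (fun _ => (1 : ℝ))) :
    ∃ K : ℝ, 0 ≤ K ∧ ∀ᶠ n : ℕ in atTop, n * (p n : ℝ) ≤ K ∧ (p n : ℝ) ≤ 1 / 2 := by
  obtain ⟨K, hK, h⟩ := hnp.exists_nonneg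
  refine ⟨K, hK, ?_⟩
  filter_upwards [h.bound, eventually_gt_atTop 0,
    tendsto_natCast_atTop_atTop.eventually_ge_atTop (2 * K)] with n h1 h2 h3
  have hp := (p n).2.1
  have hn : (0 : ℝ) < n := by exact_mod_cast h2
  rw [Real.norm_of_nonneg (by positivity), norm_one, mul_one] at h1
  refine ⟨h1, ?_⟩
  by_contra hc
  push Not at hc
  nlinarith

lemma isBigO_isolated (hN : HasLaw N (gaussianReal 0 1) P)
    (hnp : (fun n : ℕ => (n : ℝ) * (p n : ℝ)) =O[atTop] (fun _ => (1 : ℝ)))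
    (hp : ∀ᶠ n in atTop, 0 < (p n : ℝ)) :
    (fun n : ℕ => kolmogorovDist (normalizedDegreeCount 0 n (p n)) (erdosRenyi n (p n)) N P)
      =O[atTop] (fun n : ℕ => (n : ℝ)⁻¹ * (p n : ℝ) ^ (-(1 / 2) : ℝ)) := by
  obtain ⟨K, hK0, hK⟩ := exists_sparse_bound hnp
  obtain ⟨C, -, hC⟩ := kolmogorovDist_isolated_le hN hK0
  refine IsBigO.of_bound C ?_
  filter_upwards [hK, hp, eventually_ge_atTop 2] with n h1 h2 h3
  rw [Real.norm_of_nonneg (kolmogorovDist_nonneg _ _ _ _), Real.norm_of_nonneg (by positivity),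
    Real.rpow_neg h2.le, ← Real.sqrt_eq_rpow]
  exact hC n (p n) h2 h1.2 h1.1 h3

lemma isBigO_degree (hN : HasLaw N (gaussianReal 0 1) P)
    (hnp : (fun n : ℕ => (n : ℝ) * (p n : ℝ)) =O[atTop] (fun _ => (1 : ℝ))) {d : ℕ} (hd : 1 ≤ d)
    (hp : ∀ᶠ n in atTop, 0 < (p n : ℝ)) :
    (fun n : ℕ => kolmogorovDist (normalizedDegreeCount d n (p n)) (erdosRenyi n (p n)) N P)
      =O[atTop]
        (fun n : ℕ => ((n : ℝ) * (p n : ℝ)) ^ (-(d : ℤ)) * (p n : ℝ) ^ (1 / 2 : ℝ)) := by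
  obtain ⟨K, hK0, hK⟩ := exists_sparse_bound hnp
  obtain ⟨C, -, hC⟩ := kolmogorovDist_degree_le hN hK0 hd
  refine IsBigO.of_bound C ?_
  filter_upwards [hK, hp, eventually_ge_atTop (2 * d)] with n h1 h2 h3
  rw [Real.norm_of_nonneg (kolmogorovDist_nonneg _ _ _ _), Real.norm_of_nonneg (by positivity),
    ← Real.sqrt_eq_rpow, zpow_neg, zpow_natCast]
  exact hC n (p n) h2 h1.2 h1.1 h3

lemma isBigO_of_liminf_pos (hN : HasLaw N (gaussianReal 0 1) P)
    (hnp : (fun n : ℕ => (n : ℝ) * (p n : ℝ)) =O[atTop] (fun _ => (1 : ℝ))) (d : ℕ)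
    (hlim : 0 < liminf (fun n : ℕ => (n : ℝ) * (p n : ℝ)) atTop) :
    (fun n : ℕ => kolmogorovDist (normalizedDegreeCount d n (p n)) (erdosRenyi n (p n)) N P)
      =O[atTop] (fun n : ℕ => (n : ℝ) ^ (-(1 / 2) : ℝ)) := by
  obtain ⟨c, hc0, hc⟩ := exists_between hlim
  have hbdd : IsBoundedUnder (· ≥ ·) atTop fun n : ℕ => (n : ℝ) * (p n : ℝ) :=
    isBoundedUnder_of ⟨0, fun n => mul_nonneg (Nat.cast_nonneg _) (p n).2.1⟩
  have hcn := eventually_lt_of_lt_liminf hc hbdd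
  have hp : ∀ᶠ n in atTop, 0 < (p n : ℝ) := by
    filter_upwards [hcn] with n h
    exact pos_of_mul_pos_right (hc0.trans h) (Nat.cast_nonneg _)
  obtain ⟨K, hK0, hK⟩ := exists_sparse_bound hnp
  rcases Nat.eq_zero_or_pos d with rfl | hd
  -- From `np > c` one gets `n⁻¹ p^{-1/2} ≤ c^{-1/2} n^{-1/2}`.
  · refine (isBigO_isolated hN hnp hp).trans (IsBigO.of_bound (√c)⁻¹ ?_)
    filter_upwards [hcn, hp, eventually_gt_atTop 0] with n h1 h2 h3
    have hn : (0 : ℝ) < n := by exact_mod_cast h3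
    rw [Real.norm_of_nonneg (by positivity), Real.norm_of_nonneg (by positivity),
      Real.rpow_neg h2.le, ← Real.sqrt_eq_rpow, Real.rpow_neg hn.le, ← Real.sqrt_eq_rpow]
    have hs : √c ≤ √(n : ℝ) * √(p n : ℝ) := by
      rw [← Real.sqrt_mul hn.le]; exact Real.sqrt_le_sqrt h1.le
    have hsc := Real.sqrt_pos.2 hc0
    calc (n : ℝ)⁻¹ * (√(p n : ℝ))⁻¹ = (√(n : ℝ) ^ 2)⁻¹ * (√(p n : ℝ))⁻¹ := by
          rw [Real.sq_sqrt hn.le]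
      _ = (√(n : ℝ) * √(p n : ℝ))⁻¹ * (√(n : ℝ))⁻¹ := by
          rw [pow_two, mul_inv, mul_inv]; ring
      _ ≤ _ := by gcongr
  -- The lower bound `np > c` controls `(np)^{-d}`, and the upper bound `np ≤ K` gives `√p ≤ √K /
  -- √n`.
  · refine (isBigO_degree hN hnp hd hp).trans (IsBigO.of_bound ((c ^ d)⁻¹ * √K) ?_)
    filter_upwards [hcn, hp, hK, eventually_gt_atTop 0] with n h1 h2 h4 h3
    have hn : (0 : ℝ) < n := by exact_mod_cast h3
    rw [Real.norm_of_nonneg (by positivity), Real.norm_of_nonneg (by positivity),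
      Real.rpow_neg hn.le, ← Real.sqrt_eq_rpow, ← Real.sqrt_eq_rpow, zpow_neg, zpow_natCast,
      mul_assoc]
    have hs : √(p n : ℝ) ≤ √K * (√(n : ℝ))⁻¹ := by
      rw [← div_eq_mul_inv, le_div_iff₀ (Real.sqrt_pos.2 hn), ← Real.sqrt_mul h2.le]
      exact Real.sqrt_le_sqrt (by linarith [h4.1])
    gcongr

end Rates

end EdgeCube

theorem theorem1p3 {Ω : Type*} [MeasurableSpace Ω] (P : Measure Ω) [IsProbabilityMeasure P]
    (N : Ω → ℝ) (hN : HasLaw N (gaussianReal 0 1) P)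
    (p : ℕ → unitInterval)
    (hnp : (fun n : ℕ => (n : ℝ) * (p n : ℝ)) =O[atTop] (fun _ => (1 : ℝ))) :
    -- part (a)
    (Tendsto (fun n : ℕ => (n : ℝ) ^ 2 * (p n : ℝ)) atTop atTop →
      (fun n : ℕ => kolmogorovDist (normalizedDegreeCount 0 n (p n)) (erdosRenyi n (p n)) N P)
        =O[atTop] (fun n : ℕ => (n : ℝ)⁻¹ * (p n : ℝ) ^ (-(1 / 2) : ℝ))) ∧
    -- part (b)
    (∀ d : ℕ,
      Tendsto (fun n : ℕ => ((n : ℝ) * (p n : ℝ)) ^ (-(d : ℤ)) * (p n : ℝ) ^ (1 / 2 : ℝ))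
        atTop (𝓝 0) →
      (0 < liminf (fun n : ℕ => (n : ℝ) * (p n : ℝ)) atTop →
        (fun n : ℕ => kolmogorovDist (normalizedDegreeCount d n (p n)) (erdosRenyi n (p n)) N P)
          =O[atTop] (fun n : ℕ => (n : ℝ) ^ (-(1 / 2) : ℝ))) ∧
      -- `p > 0` for all large `n` makes the negative power of `n p` meaningful
      (1 ≤ d → (∀ᶠ n in atTop, 0 < (p n : ℝ)) →
        Tendsto (fun n : ℕ => (n : ℝ) * (p n : ℝ)) atTop (𝓝 0) →
        (fun n : ℕ => kolmogorovDist (normalizedDegreeCount d n (p n)) (erdosRenyi n (p n)) N P)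
          =O[atTop]
            (fun n : ℕ => ((n : ℝ) * (p n : ℝ)) ^ (-(d : ℤ)) * (p n : ℝ) ^ (1 / 2 : ℝ)))) := by
  refine ⟨fun h => EdgeCube.isBigO_isolated hN hnp ?_, fun d _ =>
    ⟨EdgeCube.isBigO_of_liminf_pos hN hnp d, fun hd hp _ => EdgeCube.isBigO_degree hN hnp hd hp⟩⟩
  -- Divergence of `n² p` forces `p > 0` eventually, so that the negative power of `p` is genuine.
  filter_upwards [h.eventually_gt_atTop 0] with n hn
  exact pos_of_mul_pos_right hn (by positivity)
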